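/- Let $N\ge 1$ be an integer, $\kappa>0$, and let $\nu=(\nu_i)$, $\theta^0=(\theta_i^0)$, $\omega^0=(\omega_i^0)\in\mathbb R^N$. For $m>0$ let $\theta(m,\cdot)=(\theta_1(m,\cdot),\dots,\theta_N(m,\cdot)):[0,\infty)\to\mathbb R^N$ be the solution of the inertial Kuramoto model $$m\ddot\theta_i+\dot\theta_i=\nu_i+\frac{\kappa}{N}\sum_{j=1}^N\sin(\theta_j-\theta_i)\quad(t>0),\qquad \theta_i(m,0)=\theta_i^0,\quad \dot\theta_i(m,0)=\omega_i^0,$$ and let $\theta(0,\cdot)$ be the solution of the first-order Kuramoto model $$\dot\theta_i=\nu_i+\frac{\kappa}{N}\sum_{j=1}^N\sin(\theta_j-\theta_i)\quad(t>0),\qquad \theta_i(0,0)=\theta_i^0 .$$ The initial data, $\nu$ and $\kappa$ do not depend on $m$. Write $\|x\|=\max_i|x_i|$ and $\mathcal D(x)=\max_{i,j}|x_i-x_j|$ for $x\in\mathbb R^N$, and $f^{(n)}$ for the $n$-th derivative in $t$ (one-sided at $t=0$). Then all these solutions are $C^\infty$ on $[0,\infty)$, and the following holds. (1) For every $i$,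 $\theta_i(m,\cdot)\to\theta_i(0,\cdot)$ as $m\to0^+$ in the Fréchet topology of $C^0[0,\infty)$, i.e. uniformly on every $[0,T]$. For all $m>0$, $t\ge0$ and $i$, $$|\theta_i(m,t)-\theta_i(0,t)|\le m\Big(2\max_j|\omega_j^0-\nu_j|+\kappa\Big)e^{2\kappa t},$$ $$\|\theta(m,t)-\theta(0,t)\|<m\left|\frac{\max_i(\omega_i^0-\nu_i)+\min_i(\omega_i^0-\nu_i)}{2}\right|+\frac12 m\big(\mathcal D(\omega^0-\nu)+2\kappa\big)e^{2\kappa t},$$ $$\mathcal D(\theta(m,t)-\theta(0,t))<m\big(\mathcal D(\omega^0-\nu)+2\kappa\big)e^{2\kappa t}.$$ (2) For every $i$, $\theta_i(m,\cdot)\to\theta_i(0,\cdot)$ as $m\to0^+$ in the Fréchet topology of $C^\infty(0,\infty)$, i.e. for every $n\ge0$ the $n$-th derivatives converge uniformly on every $[T_1,T_2]\subset(0,\infty)$. For all $n\ge1$, $m>0$, $t\ge0$ and $i$, $$|\theta_i^{(n)}(m,t)-\theta_i^{(n)}(0,t)|\le(n+1)!\,2^n\Big(\kappa+\max_j|\omega_j^0|+\max_j|\nu_j|+\frac1m\Big)^n\left[\Big(1+\frac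 tm\Big)^ne^{-t/m}\big(1+m\kappa e^{2\kappa t}\big)+m\kappa e^{2\kappa t}\right].$$ (3) For all $m>0$ and $t\ge0$, $$\|\dot\theta(m,t)-\dot\theta(0,t)\|<\big(\|\omega^0-\nu\|+\kappa\big)e^{-t/m}+m\kappa\big(\mathcal D(\nu)+2\kappa\big)+m\kappa\big(\mathcal D(\omega^0-\nu)+2\kappa\big)e^{2\kappa t},$$ $$\mathcal D(\dot\theta(m,t)-\dot\theta(0,t))<\big(\mathcal D(\omega^0-\nu)+2\kappa\big)e^{-t/m}+2m\kappa\big(\mathcal D(\nu)+2\kappa\big)+2m\kappa\big(\mathcal D(\omega^0-\nu)+2\kappa\big)e^{2\kappa t}.$$ (4) Put $A=2\kappa+\mathcal D(\omega^0)+\mathcal D(\nu)$. For all $n\ge2$, $m>0$ and $t\ge0$, $$\begin{aligned}\|\theta^{(n)}(m,t)-\theta^{(n)}(0,t)\|\le{}&(n-1)!\Big(2\kappa+\|\omega^0\|+\|\nu\|+\frac9{8m}\Big)^n\Big(1+\frac tm\Big)^ne^{-t/m}\\&+\frac98m\kappa\,n!\,e^{2\kappa t}\Big(A+\frac9{8m}\Big)^n\Big(1+\frac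 tm\Big)^ne^{-t/m}+\frac34m\kappa\,(n+1)!\,e^{2\kappa t}A^n\big(1-e^{-t/m}\big),\end{aligned}$$ $$\begin{aligned}\mathcal D(\theta^{(n)}(m,t)-\theta^{(n)}(0,t))\le{}&2(n-1)!\Big(A+\frac9{8m}\Big)^n\Big(1+\frac tm\Big)^ne^{-t/m}\\&+\frac32(n+1)!\,m\kappa\,e^{2\kappa t}\Big(A+\frac9{8m}\Big)^n\Big(1+\frac tm\Big)^ne^{-t/m}+\frac32(n+1)!\,m\kappa\,e^{2\kappa t}A^n\big(1-e^{-t/m}\big).\end{aligned}$$ -/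

import Mathlib

open scoped ContDiff Topology

noncomputable section

/-- The Kuramoto velocity field `ν i + (κ / N) ∑ j, sin (x j - x i)`. -/
def kuramotoField {N : ℕ} (κ : ℝ) (ν x : Fin N → ℝ) (i : Fin N) : ℝ :=
  ν i + κ / (N : ℝ) * ∑ j : Fin N, Real.sin (x j - x i)

/-- The vector of `n`-th time derivatives at time `t` of functions on `[0, ∞)`
(one-sided derivatives at `t = 0`; the values themselves for `n = 0`). -/
def timeDeriv {N : ℕ} (n : ℕ) (x : Fin N → ℝ → ℝ) (t : ℝ) : Fin N → ℝ :=
  fun i => iteratedDerivWithin n (x i) (Set.Ici 0) t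

/-- `x` is a (classical) solution on `[0, ∞)` of the inertial Kuramoto Cauchy problem
`m x'' + x' = kuramotoField κ ν x` for `t > 0`, `x(0) = x₀`, `x'(0) = v₀`. -/
structure IsInertialKuramotoSolution {N : ℕ} (m κ : ℝ) (ν x₀ v₀ : Fin N → ℝ)
    (x : Fin N → ℝ → ℝ) : Prop where
  regular : ∀ i, ContDiffOn ℝ 2 (x i) (Set.Ici 0)
  ode : ∀ t : ℝ, 0 < t → ∀ i,
    m * timeDeriv 2 x t i + timeDeriv 1 x t i = kuramotoField κ ν (fun j => x j t) i
  init_pos : ∀ i, x i 0 = x₀ i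
  init_vel : ∀ i, timeDeriv 1 x 0 i = v₀ i

/-- `x` is a (classical) solution on `[0, ∞)` of the first-order Kuramoto Cauchy problem
`x' = kuramotoField κ ν x` for `t > 0`, `x(0) = x₀`. -/
structure IsKuramotoSolution {N : ℕ} (κ : ℝ) (ν x₀ : Fin N → ℝ)
    (x : Fin N → ℝ → ℝ) : Prop where
  regular : ∀ i, ContDiffOn ℝ 1 (x i) (Set.Ici 0)
  ode : ∀ t : ℝ, 0 < t → ∀ i, timeDeriv 1 x t i = kuramotoField κ ν (fun j => x j t) i
  init_pos : ∀ i, x i 0 = x₀ i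

/-- The diameter `max_{i,j} |x i - x j|` of a vector. -/
def vecDiam {N : ℕ} (x : Fin N → ℝ) : ℝ :=
  ⨆ p : Fin N × Fin N, |x p.1 - x p.2|

/-- `f m → g` as `m → 0+` in the Fréchet topology of `C⁰[0, ∞)`: uniformly on every `[0, T]`. -/
def TendstoC0 (f : ℝ → ℝ → ℝ) (g : ℝ → ℝ) : Prop :=
  (∀ m : ℝ, 0 < m → ContinuousOn (f m) (Set.Ici 0)) ∧ ContinuousOn g (Set.Ici 0) ∧
  ∀ T : ℝ, 0 < T → TendstoUniformlyOn f g (𝓝[>] 0) (Set.Icc 0 T)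

/-- `f m → g` as `m → 0+` in the Fréchet topology of `C^∞(0, ∞)`: all derivatives converge
uniformly on every compact interval `[T₁, T₂]` in `(0, ∞)`. -/
def TendstoCInfty (f : ℝ → ℝ → ℝ) (g : ℝ → ℝ) : Prop :=
  (∀ m : ℝ, 0 < m → ContDiffOn ℝ ∞ (f m) (Set.Ioi 0)) ∧ ContDiffOn ℝ ∞ g (Set.Ioi 0) ∧
  ∀ (n : ℕ) (T₁ T₂ : ℝ), 0 < T₁ → T₁ < T₂ →
    TendstoUniformlyOn (fun m => iteratedDerivWithin n (f m) (Set.Ioi 0))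
      (iteratedDerivWithin n g (Set.Ioi 0)) (𝓝[>] 0) (Set.Icc T₁ T₂)

end

/-! Everything is measured against the operator f ↦ m f' + f. The factor e^{t/m} turns it into an
exact derivative, so a majorant B with |f(0)| ≤ B(0) and |m f' + f| ≤ m B' + B dominates f
(`abs_le_of_relaxation`). The work lies in bounding forcing terms and choosing majorants.

Phases. Let x solve the inertial model, y the first-order model, and F be the field. The combination
x - y + m(x' - ω₀) vanishes at 0 and has derivative F(x) - F(y), free of second derivatives. The
field sees only phase differences, through a 1-Lipschitz sine, so Grönwall closes on the diameter
with rate 2κ; the correction m(x' - ω₀) costs O(m) (`abs_phase_pair_sub_le`). Individual phases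
follow by one integration.

Derivatives. After n differentiations, m x^(n+2) + x^(n+1) = F(x)^(n), while y satisfies the same
type of equation up to the defect m y^(n+2). A derivative of a shifted sine is φ' times another
shifted sine, so Leibniz's rule turns bounds k! G(k+1) on phase derivatives into n! G(n) on the
sine, provided G is supermultiplicative. Two majorants fit: the initial layer (P(1+t/m))^n e^{-t/m}
with P of size 1/m, and the bulk A^n (1 - e^{-t/m}). The operator sends layer n+1 to (n+1)P times
layer n and bulk n to A^n, and layer plus bulk is supermultiplicative.

Strong induction on the order then bounds the derivatives of each model
(`kuramoto_timeDeriv_pair_le`, `inertial_timeDeriv_pair_le`) and of their difference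
(`difference_timeDeriv_pair_le`). The difference consists of a layer and a part carrying m e^{2κt}.
Away from t = 0 the layer is a polynomial in 1/m times e^{-t/m}, which gives convergence of all
derivatives. -/

section

open Set Filter

/-! ### Scalar comparison principle -/

/-- Comparison principle for the relaxation equation `m f' + f = g` on `[0, ∞)`. -/
theorem abs_le_of_relaxation {m : ℝ} (hm : 0 < m) {f f' B B' : ℝ → ℝ}
    (hf : ∀ t ∈ Ici (0 : ℝ), HasDerivWithinAt f (f' t) (Ici 0) t)
    (hB : ∀ t, HasDerivAt B (B' t) t) (h0 : |f 0| ≤ B 0)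
    (h : ∀ t, 0 ≤ t → |m * f' t + f t| ≤ m * B' t + B t) {t : ℝ} (ht : 0 ≤ t) :
    |f t| ≤ B t := by
  have hexp : ∀ s : ℝ, HasDerivAt (fun s => Real.exp (s / m)) (Real.exp (s / m) * (1 / m)) s :=
    fun s => ((hasDerivAt_id s).div_const m).exp
  have key := image_norm_le_of_norm_deriv_right_le_deriv_boundary (a := 0) (b := t)
    (f := fun s => Real.exp (s / m) * f s)
    (f' := fun s => Real.exp (s / m) * (1 / m) * f s + Real.exp (s / m) * f' s)
    (B := fun s => Real.exp (s / m) * B s)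
    (B' := fun s => Real.exp (s / m) * (1 / m) * B s + Real.exp (s / m) * B' s)
    (fun s hs => ((hexp s).continuousAt.continuousWithinAt).mul
      ((hf s hs.1).continuousWithinAt.mono Icc_subset_Ici_self))
    (fun s hs => (hexp s).hasDerivWithinAt.mul ((hf s hs.1).mono (Ici_subset_Ici.2 hs.1)))
    (by simpa using h0) (fun s => (hexp s).mul (hB s))
    (fun s hs => by
      have hc : 0 < Real.exp (s / m) * (1 / m) := by positivity
      have e1 : Real.exp (s / m) * (1 / m) * f s + Real.exp (s / m) * f' s =
          Real.exp (s / m) * (1 / m) * (m * f' s + f s) := by field_simp; ring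
      have e2 : Real.exp (s / m) * (1 / m) * B s + Real.exp (s / m) * B' s =
          Real.exp (s / m) * (1 / m) * (m * B' s + B s) := by field_simp; ring
      rw [e1, e2, Real.norm_eq_abs, abs_mul, abs_of_pos hc]
      exact mul_le_mul_of_nonneg_left (h s hs.1) hc.le)
    (right_mem_Icc.2 ht)
  rw [Real.norm_eq_abs, abs_mul, abs_of_pos (Real.exp_pos _)] at key
  exact le_of_mul_le_mul_left key (Real.exp_pos _)

theorem hasDerivWithinAt_iteratedDerivWithin {f : ℝ → ℝ} {s : Set ℝ} (hs : UniqueDiffOn ℝ s)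
    (hf : ContDiffOn ℝ ∞ f s) (n : ℕ) {t : ℝ} (ht : t ∈ s) :
    HasDerivWithinAt (iteratedDerivWithin n f s) (iteratedDerivWithin (n + 1) f s t) s t := by
  rw [iteratedDerivWithin_succ]
  exact (hf.differentiableOn_iteratedDerivWithin (by exact_mod_cast ENat.natCast_lt_top n) hs
    t ht).hasDerivWithinAt

/-! ### Derivatives of shifted sines and of their differences -/

section Sine

variable {s : Set ℝ} {φ ψ : ℝ → ℝ} {t : ℝ}

theorem contDiffOn_sin_add (hφ : ContDiffOn ℝ ∞ φ s) (c : ℝ) :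
    ContDiffOn ℝ ∞ (fun τ => Real.sin (φ τ + c)) s :=
  Real.contDiff_sin.comp_contDiffOn (hφ.add contDiffOn_const)

theorem contDiffOn_derivWithin_of_infty (hs : UniqueDiffOn ℝ s) (hφ : ContDiffOn ℝ ∞ φ s) :
    ContDiffOn ℝ ∞ (derivWithin φ s) s :=
  ((contDiffOn_infty_iff_derivWithin hs).1 hφ).2

/-- Treating cosine as a sine shifted by π/2 keeps the family closed under differentiation, so later
inductions leave c free and never alternate between sine and cosine. The rest is Leibniz's rule. -/
theorem iteratedDerivWithin_succ_sin_add (hs : UniqueDiffOn ℝ s) (hφ : ContDiffOn ℝ ∞ φ s)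
    (ht : t ∈ s) (n : ℕ) (c : ℝ) :
    iteratedDerivWithin (n + 1) (fun τ => Real.sin (φ τ + c)) s t =
      ∑ k ∈ Finset.range (n + 1), n.choose k * iteratedDerivWithin (k + 1) φ s t *
        iteratedDerivWithin (n - k) (fun τ => Real.sin (φ τ + (c + Real.pi / 2))) s t := by
  rw [iteratedDerivWithin_succ']
  have h : EqOn (derivWithin (fun τ => Real.sin (φ τ + c)) s)
      (derivWithin φ s * fun τ => Real.sin (φ τ + (c + Real.pi / 2))) s := by
    intro τ hτ
    have hd : HasDerivWithinAt φ (derivWithin φ s τ) s τ :=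
      (hφ.differentiableOn (by simp) τ hτ).hasDerivWithinAt
    rw [((hd.add_const c).sin).derivWithin (hs τ hτ), Pi.mul_apply, ← add_assoc,
      Real.sin_add_pi_div_two, mul_comm]
  rw [iteratedDerivWithin_congr h ht, iteratedDerivWithin_mul ht hs
    ((contDiffOn_derivWithin_of_infty hs hφ t ht).of_le (by exact_mod_cast le_top))
    ((contDiffOn_sin_add hφ _ t ht).of_le (by exact_mod_cast le_top))]
  simp only [iteratedDerivWithin_succ']

theorem choose_mul_factorial_mul_factorial_real {n k : ℕ} (hk : k ∈ Finset.range (n + 1)) :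
    (n.choose k : ℝ) * (k.factorial : ℝ) * ((n - k).factorial : ℝ) = (n.factorial : ℝ) := by
  exact_mod_cast Nat.choose_mul_factorial_mul_factorial (Nat.lt_succ_iff.1 (Finset.mem_range.1 hk))

/-- Derivatives of a shifted sine are controlled by a supermultiplicative majorant. -/
theorem abs_iteratedDerivWithin_sin_add_le (hs : UniqueDiffOn ℝ s) (hφ : ContDiffOn ℝ ∞ φ s)
    (ht : t ∈ s) {G : ℕ → ℝ} (hG0 : 1 ≤ G 0) (hG : ∀ k, 0 ≤ G k)
    (hmul : ∀ k l, G k * G l ≤ G (k + l)) (n : ℕ)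
    (h : ∀ k < n, |iteratedDerivWithin (k + 1) φ s t| ≤ k.factorial * G (k + 1)) (c : ℝ) :
    |iteratedDerivWithin n (fun τ => Real.sin (φ τ + c)) s t| ≤ n.factorial * G n := by
  induction n using Nat.strong_induction_on generalizing c with
  | _ n ih =>
    cases n with
    | zero => simpa using (Real.abs_sin_le_one _).trans hG0
    | succ n =>
      rw [iteratedDerivWithin_succ_sin_add hs hφ ht]
      refine (Finset.abs_sum_le_sum_abs _ _).trans ?_
      have : ∀ k ∈ Finset.range (n + 1), |(n.choose k : ℝ) * iteratedDerivWithin (k + 1) φ s t *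
          iteratedDerivWithin (n - k) (fun τ => Real.sin (φ τ + (c + Real.pi / 2))) s t|
          ≤ n.factorial * G (n + 1) := by
        intro k hk
        have hk' := Finset.mem_range.1 hk
        have h1 := h k hk'
        have h2 := ih (n - k) (by omega) (fun j hj => h j (by omega)) (c + Real.pi / 2)
        have h3 := hmul (k + 1) (n - k)
        rw [show k + 1 + (n - k) = n + 1 by omega] at h3
        -- The binomial coefficient merges the two factorials into n!, so all n + 1 Leibniz terms
        -- share one bound and add up to (n + 1)! G (n + 1).
        rw [← choose_mul_factorial_mul_factorial_real hk, abs_mul, abs_mul, Nat.abs_cast]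
        calc _ ≤ (n.choose k : ℝ) * (k.factorial * G (k + 1)) * ((n - k).factorial * G (n - k)) := by
              have := hG (k + 1)
              gcongr
          _ = n.choose k * k.factorial * (n - k).factorial * (G (k + 1) * G (n - k)) := by ring
          _ ≤ _ := by gcongr
      refine (Finset.sum_le_sum this).trans (le_of_eq ?_)
      simp [Nat.factorial_succ]
      ring

/-- The weights (k+1)(k+4) for phases and k(k+7)/2 for sines are matched: with p = n + 1, the
Leibniz sum is p times p(p+7)/2, so the sine weight reproduces itself exactly. -/
theorem sum_range_quadratic_majorant (n : ℕ) :
    ∑ k ∈ Finset.range (n + 1), ((k + 1 : ℝ) * (k + 4) + k * (k + 7) / 2) =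
      (n + 1) * ((n + 1) * (n + 8) / 2) := by
  induction n with
  | zero => norm_num
  | succ n ih => rw [Finset.sum_range_succ, ih]; push_cast; ring

/-- Derivatives of the difference of two shifted sines, in terms of majorants `H` for the
initial layer, `L` for the bulk, and `G` for their sum. -/
theorem abs_iteratedDerivWithin_sin_add_sub_le (hs : UniqueDiffOn ℝ s)
    (hφ : ContDiffOn ℝ ∞ φ s) (hψ : ContDiffOn ℝ ∞ ψ s) (ht : t ∈ s)
    {G H L : ℕ → ℝ} {A ε ρ : ℝ} (hA : 0 ≤ A) (hε : 0 ≤ ε) (hρ : 0 ≤ ρ)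
    (hG0 : 1 ≤ G 0) (hG : ∀ k, 0 ≤ G k) (hH : ∀ k, 0 ≤ H k) (hL : ∀ k, 0 ≤ L k)
    (hGG : ∀ k l, G k * G l ≤ G (k + l)) (hHG : ∀ k l, H k * G l ≤ H (k + l))
    (hAH : ∀ k l, A ^ k * H l ≤ H (k + l)) (hAG : ∀ k l, A ^ k * G l ≤ G (k + l))
    (hAL : ∀ k l, A ^ k * L l ≤ L (k + l)) (n : ℕ)
    (h1 : ∀ k < n, |iteratedDerivWithin (k + 1) φ s t| ≤ k.factorial * G (k + 1))
    (h2 : ∀ k < n, |iteratedDerivWithin (k + 1) ψ s t| ≤ k.factorial * A ^ (k + 1))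
    (h3 : ∀ k < n, |iteratedDerivWithin (k + 1) φ s t - iteratedDerivWithin (k + 1) ψ s t| ≤
      k.factorial * (2 * H (k + 1) + ε * ((k + 1) * (k + 4)) * G (k + 1)))
    (h4 : |φ t - ψ t| ≤ ρ * L 0) (c : ℝ) :
    |iteratedDerivWithin n (fun τ => Real.sin (φ τ + c)) s t -
        iteratedDerivWithin n (fun τ => Real.sin (ψ τ + c)) s t| ≤
      n.factorial * (2 * n * H n + ε * (n * (n + 7) / 2) * G n + ρ * L n) := by
  induction n using Nat.strong_induction_on generalizing c with
  | _ n ih =>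
    cases n with
    | zero =>
      have : |Real.sin (φ t + c) - Real.sin (ψ t + c)| ≤ |φ t - ψ t| := by
        simpa [Real.dist_eq] using Real.lipschitzWith_sin.dist_le_mul (φ t + c) (ψ t + c)
      simpa using this.trans h4
    | succ n =>
      rw [iteratedDerivWithin_succ_sin_add hs hφ ht, iteratedDerivWithin_succ_sin_add hs hψ ht,
        ← Finset.sum_sub_distrib]
      refine (Finset.abs_sum_le_sum_abs _ _).trans ?_
      set c' := c + Real.pi / 2
      have : ∀ k ∈ Finset.range (n + 1),
          |(n.choose k : ℝ) * iteratedDerivWithin (k + 1) φ s t *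
            iteratedDerivWithin (n - k) (fun τ => Real.sin (φ τ + c')) s t -
            (n.choose k : ℝ) * iteratedDerivWithin (k + 1) ψ s t *
            iteratedDerivWithin (n - k) (fun τ => Real.sin (ψ τ + c')) s t|
          ≤ n.factorial * ((2 + 2 * ((n - k : ℕ) : ℝ)) * H (n + 1) +
            ε * ((k + 1 : ℝ) * (k + 4) + ((n - k : ℕ) : ℝ) * ((n - k : ℕ) + 7) / 2) * G (n + 1)
              + ρ * L (n + 1)) := by
        intro k hk
        have hk' := Finset.mem_range.1 hk
        have e1 := h3 k hk'
        have e2 := abs_iteratedDerivWithin_sin_add_le hs hφ ht hG0 hG hGG (n - k)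
          (fun j hj => h1 j (by omega)) c'
        have e3 := h2 k hk'
        have e4 := ih (n - k) (by omega) (fun j hj => h1 j (by omega)) (fun j hj => h2 j (by omega))
          (fun j hj => h3 j (by omega)) c'
        have hk2 : k + 1 + (n - k) = n + 1 := by omega
        have m1 := hHG (k + 1) (n - k)
        have m2 := hGG (k + 1) (n - k)
        have m3 := hAH (k + 1) (n - k)
        have m4 := hAG (k + 1) (n - k)
        have m5 := hAL (k + 1) (n - k)
        rw [hk2] at m1 m2 m3 m4 m5
        rw [← choose_mul_factorial_mul_factorial_real hk]
        generalize iteratedDerivWithin (n - k) (fun τ => Real.sin (φ τ + c')) s t = u at *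
        generalize iteratedDerivWithin (n - k) (fun τ => Real.sin (ψ τ + c')) s t = v at *
        generalize iteratedDerivWithin (k + 1) φ s t = a at *
        generalize iteratedDerivWithin (k + 1) ψ s t = b at *
        generalize n - k = l at *
        have hH1 := hH (k + 1)
        have hG1 := hG (k + 1)
        have hGl := hG l
        have hHl := hH l
        have hLl := hL l
        -- Splitting a u - b v as (a - b) u + b (u - v) pairs a difference of phases with the full
        -- majorant `G`, and a difference of sines only with a power of `A`. Hence `L` never has to
        -- be multiplied by `G`.
        calc |(n.choose k : ℝ) * a * u - n.choose k * b * v|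
            = n.choose k * |(a - b) * u + b * (u - v)| := by
              rw [← Nat.abs_cast (n.choose k), ← abs_mul, Nat.abs_cast]; congr 1; ring
          _ ≤ n.choose k * (|a - b| * |u| + |b| * |u - v|) := by
              gcongr
              exact (abs_add_le _ _).trans (by rw [abs_mul, abs_mul])
          _ ≤ n.choose k * ((k.factorial * (2 * H (k + 1) + ε * ((k + 1) * (k + 4)) * G (k + 1))) *
                (l.factorial * G l) + (k.factorial * A ^ (k + 1)) *
                (l.factorial * (2 * l * H l + ε * (l * (l + 7) / 2) * G l + ρ * L l))) := by
              gcongr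
          _ = n.choose k * k.factorial * l.factorial * (2 * (H (k + 1) * G l) +
                2 * l * (A ^ (k + 1) * H l) +
                ε * ((k + 1) * (k + 4)) * (G (k + 1) * G l) +
                ε * (l * (l + 7) / 2) * (A ^ (k + 1) * G l) + ρ * (A ^ (k + 1) * L l)) := by ring
          _ ≤ n.choose k * k.factorial * l.factorial * (2 * H (n + 1) + 2 * l * H (n + 1) +
                ε * ((k + 1) * (k + 4)) * G (n + 1) + ε * (l * (l + 7) / 2) * G (n + 1) +
                ρ * L (n + 1)) := by gcongr
          _ = _ := by ring
      refine (Finset.sum_le_sum this).trans ?_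
      rw [← Finset.mul_sum, Nat.factorial_succ]
      have hrefl : ∑ k ∈ Finset.range (n + 1),
          ((2 + 2 * ((n - k : ℕ) : ℝ)) * H (n + 1) +
            ε * ((k + 1 : ℝ) * (k + 4) + ((n - k : ℕ) : ℝ) * ((n - k : ℕ) + 7) / 2) * G (n + 1)
              + ρ * L (n + 1)) =
          (∑ k ∈ Finset.range (n + 1), (2 + 2 * (k : ℝ))) * H (n + 1) +
          ε * (∑ k ∈ Finset.range (n + 1), ((k + 1 : ℝ) * (k + 4) + k * (k + 7) / 2)) * G (n + 1)
          + (n + 1) * (ρ * L (n + 1)) := by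
        have r1 := Finset.sum_range_reflect (fun k : ℕ => (2 + 2 * (k : ℝ))) (n + 1)
        have r2 := Finset.sum_range_reflect (fun k : ℕ => (k : ℝ) * (k + 7) / 2) (n + 1)
        simp only [add_tsub_cancel_right] at r1 r2
        simp only [Finset.sum_add_distrib, ← Finset.sum_mul, ← Finset.mul_sum] at r1 r2 ⊢
        rw [r1, r2]
        simp [mul_assoc]
      -- Only the coefficient of `H` is rounded up, from (n+1)(n+2) to (n+1) · 2(n+1); those of `G`
      -- and `L` come out exactly.
      have hs2 : ∑ k ∈ Finset.range (n + 1), (2 + 2 * (k : ℝ)) = (n + 1) * (n + 2) := by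
        clear * -
        induction n with
        | zero => norm_num
        | succ n ih => rw [Finset.sum_range_succ, ih]; push_cast; ring
      rw [hrefl, hs2, sum_range_quadratic_majorant]
      have hH1 := hH (n + 1)
      push_cast
      rw [show ((n : ℝ) + 1) * n.factorial *
          (2 * (n + 1) * H (n + 1) + ε * ((n + 1) * (n + 1 + 7) / 2) * G (n + 1) + ρ * L (n + 1)) =
          n.factorial * ((n + 1) * (2 * (n + 1)) * H (n + 1) +
            ε * ((n + 1) * ((n + 1) * (n + 8) / 2)) * G (n + 1) + (n + 1) * (ρ * L (n + 1))) by ring]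
      gcongr
      linarith [(Nat.cast_nonneg n : (0 : ℝ) ≤ n)]

end Sine

/-- The equations are imposed only for t > 0; continuity carries them to t = 0, where the initial
values of higher derivatives are read off. -/
theorem eqOn_Ici_of_eqOn_Ioi {f g : ℝ → ℝ} (hf : ContinuousOn f (Ici 0))
    (hg : ContinuousOn g (Ici 0)) (h : ∀ t, 0 < t → f t = g t) : EqOn f g (Ici 0) :=
  EqOn.of_subset_closure (s := Ioi 0) h hf hg Ioi_subset_Ici_self (by simp)

/-! ### Estimates for the Kuramoto field -/

section Field

variable {N : ℕ} {κ : ℝ} {ν : Fin N → ℝ} {s : Set ℝ}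

theorem contDiffOn_kuramotoField {n : WithTop ℕ∞} {x : Fin N → ℝ → ℝ}
    (hx : ∀ i, ContDiffOn ℝ n (x i) s) (i : Fin N) :
    ContDiffOn ℝ n (fun t => kuramotoField κ ν (fun j => x j t) i) s := by
  unfold kuramotoField
  exact contDiffOn_const.add (contDiffOn_const.mul
    (ContDiffOn.sum fun j _ => Real.contDiff_sin.comp_contDiffOn ((hx j).sub (hx i))))

theorem abs_mean_le (hN : 0 < N) (hκ : 0 ≤ κ) {a : Fin N → ℝ} {M : ℝ} (h : ∀ j, |a j| ≤ M) :
    |κ / (N : ℝ) * ∑ j, a j| ≤ κ * M := by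
  have hN' : (0 : ℝ) < N := by exact_mod_cast hN
  rw [abs_mul, abs_of_nonneg (by positivity)]
  calc κ / N * |∑ j, a j| ≤ κ / N * ∑ _j : Fin N, M := by
        gcongr
        exact (Finset.abs_sum_le_sum_abs _ _).trans (Finset.sum_le_sum fun j _ => h j)
    _ = κ * M := by simp; field_simp

theorem abs_kuramotoField_sub_le (hN : 0 < N) (hκ : 0 ≤ κ) (x : Fin N → ℝ) (i : Fin N) :
    |kuramotoField κ ν x i - ν i| ≤ κ := by
  have := abs_mean_le hN hκ (a := fun j => Real.sin (x j - x i)) (M := 1)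
    fun j => Real.abs_sin_le_one _
  simpa [kuramotoField] using this

/-- The ν terms cancel and only phase differences enter, so control of the diameter suffices. This
is what lets the Grönwall argument close. -/
theorem abs_kuramotoField_sub_kuramotoField_le (hN : 0 < N) (hκ : 0 ≤ κ) {x y : Fin N → ℝ} {M : ℝ}
    (h : ∀ i j, |(x i - y i) - (x j - y j)| ≤ M) (i : Fin N) :
    |kuramotoField κ ν x i - kuramotoField κ ν y i| ≤ κ * M := by
  have := abs_mean_le hN hκ (a := fun j => Real.sin (x j - x i) - Real.sin (y j - y i)) (M := M)
    fun j => (Real.lipschitzWith_sin.dist_le_mul (x j - x i) (y j - y i)).trans (by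
      have := h j i
      rw [NNReal.coe_one, one_mul, Real.dist_eq]
      rwa [show x j - x i - (y j - y i) = x j - y j - (x i - y i) by ring])
  rw [Finset.sum_sub_distrib, mul_sub] at this
  simpa [kuramotoField] using this

theorem iteratedDerivWithin_kuramotoField (hs : UniqueDiffOn ℝ s) {x : Fin N → ℝ → ℝ}
    (hx : ∀ i, ContDiffOn ℝ ∞ (x i) s) {n : ℕ} (hn : 0 < n) {t : ℝ} (ht : t ∈ s) (i : Fin N) :
    iteratedDerivWithin n (fun t => kuramotoField κ ν (fun j => x j t) i) s t =
      κ / (N : ℝ) * ∑ j, iteratedDerivWithin n (fun τ => Real.sin (x j τ - x i τ + 0)) s t := by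
  unfold kuramotoField
  rw [iteratedDerivWithin_const_add hn, iteratedDerivWithin_const_mul_field,
    iteratedDerivWithin_fun_sum ht hs]
  · simp
  · intro j _
    exact (Real.contDiff_sin.comp_contDiffOn ((hx j).sub (hx i)) t ht).of_le
      (by exact_mod_cast le_top)

theorem abs_iteratedDerivWithin_kuramotoField_le (hN : 0 < N) (hκ : 0 ≤ κ)
    (hs : UniqueDiffOn ℝ s) {x : Fin N → ℝ → ℝ}
    (hx : ∀ i, ContDiffOn ℝ ∞ (x i) s) {n : ℕ} (hn : 0 < n) {t : ℝ} (ht : t ∈ s) {M : ℝ}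
    (h : ∀ i j, |iteratedDerivWithin n (fun τ => Real.sin (x j τ - x i τ + 0)) s t| ≤ M)
    (i : Fin N) :
    |iteratedDerivWithin n (fun t => kuramotoField κ ν (fun j => x j t) i) s t| ≤ κ * M := by
  rw [iteratedDerivWithin_kuramotoField hs hx hn ht]
  exact abs_mean_le hN hκ (h i)

theorem abs_iteratedDerivWithin_kuramotoField_sub_le (hN : 0 < N) (hκ : 0 ≤ κ)
    (hs : UniqueDiffOn ℝ s) {x y : Fin N → ℝ → ℝ}
    (hx : ∀ i, ContDiffOn ℝ ∞ (x i) s) (hy : ∀ i, ContDiffOn ℝ ∞ (y i) s)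
    {n : ℕ} {t : ℝ} (ht : t ∈ s) {M : ℝ}
    (h : ∀ i j, |iteratedDerivWithin n (fun τ => Real.sin (x j τ - x i τ + 0)) s t -
      iteratedDerivWithin n (fun τ => Real.sin (y j τ - y i τ + 0)) s t| ≤ M) (i : Fin N) :
    |iteratedDerivWithin n (fun t => kuramotoField κ ν (fun j => x j t) i) s t -
      iteratedDerivWithin n (fun t => kuramotoField κ ν (fun j => y j t) i) s t| ≤ κ * M := by
  rcases Nat.eq_zero_or_pos n with rfl | hn
  · have := abs_mean_le hN hκ (h i)
    rw [Finset.sum_sub_distrib, mul_sub] at this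
    simpa [kuramotoField] using this
  · rw [iteratedDerivWithin_kuramotoField hs hx hn ht, iteratedDerivWithin_kuramotoField hs hy hn ht,
      ← mul_sub, ← Finset.sum_sub_distrib]
    exact abs_mean_le hN hκ (h i)

end Field

/-! ### Smoothness and the differentiated equations -/

section Solutions

variable {N : ℕ} {m κ : ℝ} {ν x₀ v₀ : Fin N → ℝ} {x : Fin N → ℝ → ℝ}

theorem contDiffOn_infty_of_succ {f : Fin N → ℝ → ℝ} {s : Set ℝ}
    (h0 : ∀ i, ContDiffOn ℝ 1 (f i) s)
    (h : ∀ n : ℕ, (∀ i, ContDiffOn ℝ (n + 1 : ℕ) (f i) s) → ∀ i, ContDiffOn ℝ (n + 2 : ℕ) (f i) s)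
    (i : Fin N) : ContDiffOn ℝ ∞ (f i) s := by
  have key : ∀ n : ℕ, ∀ i, ContDiffOn ℝ (n + 1 : ℕ) (f i) s := by
    intro n
    induction n with
    | zero => simpa using h0
    | succ n ih => exact h n ih
  exact contDiffOn_infty.2 fun n => (key n i).of_le (by exact_mod_cast Nat.le_succ n)

theorem contDiffOn_succ_of_derivWithin {f : ℝ → ℝ} {n : ℕ} {s : Set ℝ} (hs : UniqueDiffOn ℝ s)
    (hf : DifferentiableOn ℝ f s) (h : ContDiffOn ℝ n (derivWithin f s) s) :
    ContDiffOn ℝ (n + 1 : ℕ) f s := by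
  have := (contDiffOn_succ_iff_derivWithin (n := (n : WithTop ℕ∞)) hs).2 ⟨hf, by simp, h⟩
  exact_mod_cast this

theorem IsKuramotoSolution.derivWithin_eqOn (h : IsKuramotoSolution κ ν x₀ x) (i : Fin N) :
    EqOn (derivWithin (x i) (Ici 0)) (fun t => kuramotoField κ ν (fun j => x j t) i) (Ici 0) :=
  eqOn_Ici_of_eqOn_Ioi ((h.regular i).continuousOn_derivWithin (uniqueDiffOn_Ici 0) le_rfl)
    (contDiffOn_kuramotoField h.regular i).continuousOn
    fun t ht => by simpa [timeDeriv, iteratedDerivWithin_one] using h.ode t ht i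

theorem IsKuramotoSolution.contDiffOn (h : IsKuramotoSolution κ ν x₀ x) (i : Fin N) :
    ContDiffOn ℝ ∞ (x i) (Ici 0) :=
  contDiffOn_infty_of_succ h.regular (fun n ih i =>
    contDiffOn_succ_of_derivWithin (uniqueDiffOn_Ici 0) ((h.regular i).differentiableOn (by simp))
      ((contDiffOn_kuramotoField ih i).congr (h.derivWithin_eqOn i))) i

theorem IsKuramotoSolution.timeDeriv_succ (h : IsKuramotoSolution κ ν x₀ x) (n : ℕ) {t : ℝ}
    (ht : 0 ≤ t) (i : Fin N) : timeDeriv (n + 1) x t i =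
      iteratedDerivWithin n (fun t => kuramotoField κ ν (fun j => x j t) i) (Ici 0) t := by
  rw [timeDeriv, iteratedDerivWithin_succ']
  exact iteratedDerivWithin_congr (h.derivWithin_eqOn i) ht

theorem IsInertialKuramotoSolution.contDiffOn_derivWithin
    (h : IsInertialKuramotoSolution m κ ν x₀ v₀ x) (i : Fin N) :
    ContDiffOn ℝ 1 (derivWithin (x i) (Ici 0)) (Ici 0) :=
  (h.regular i).derivWithin (uniqueDiffOn_Ici 0) (by norm_num)

theorem IsInertialKuramotoSolution.derivWithin_eqOn (h : IsInertialKuramotoSolution m κ ν x₀ v₀ x)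
    (i : Fin N) :
    EqOn (fun t => m * derivWithin (derivWithin (x i) (Ici 0)) (Ici 0) t +
        derivWithin (x i) (Ici 0) t)
      (fun t => kuramotoField κ ν (fun j => x j t) i) (Ici 0) :=
  eqOn_Ici_of_eqOn_Ioi
    ((continuousOn_const.mul ((h.contDiffOn_derivWithin i).continuousOn_derivWithin
      (uniqueDiffOn_Ici 0) le_rfl)).add (h.contDiffOn_derivWithin i).continuousOn)
    (contDiffOn_kuramotoField h.regular i).continuousOn
    fun t ht => by
      simpa [timeDeriv, iteratedDerivWithin_one, iteratedDerivWithin_succ'] using h.ode t ht i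

/-- Bootstrap: dividing by m expresses the second derivative through the field and the velocity, so
phases of class C^{n+1} have a second derivative of class C^n and gain one order. -/
theorem IsInertialKuramotoSolution.contDiffOn (hm : 0 < m)
    (h : IsInertialKuramotoSolution m κ ν x₀ v₀ x) (i : Fin N) :
    ContDiffOn ℝ ∞ (x i) (Ici 0) := by
  refine contDiffOn_infty_of_succ (fun i => (h.regular i).of_le (by norm_num)) (fun n ih i => ?_) i
  refine contDiffOn_succ_of_derivWithin (uniqueDiffOn_Ici 0)
    ((h.regular i).differentiableOn (by simp)) ?_
  refine contDiffOn_succ_of_derivWithin (uniqueDiffOn_Ici 0)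
    ((h.contDiffOn_derivWithin i).differentiableOn (by simp)) ?_
  refine ContDiffOn.congr (f := fun t => m⁻¹ * (kuramotoField κ ν (fun j => x j t) i -
    derivWithin (x i) (Ici 0) t)) ?_ fun t ht => ?_
  · refine contDiffOn_const.mul (ContDiffOn.sub ?_ ?_)
    · exact (contDiffOn_kuramotoField ih i).of_le (by exact_mod_cast Nat.le_succ n)
    · exact (ih i).derivWithin (uniqueDiffOn_Ici 0) (by exact_mod_cast le_rfl)
  · have := h.derivWithin_eqOn i ht
    simp only at this
    rw [← this]
    field_simp
    ring

theorem IsInertialKuramotoSolution.relaxation (hm : 0 < m)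
    (h : IsInertialKuramotoSolution m κ ν x₀ v₀ x) (n : ℕ) {t : ℝ} (ht : 0 ≤ t) (i : Fin N) :
    m * timeDeriv (n + 2) x t i + timeDeriv (n + 1) x t i =
      iteratedDerivWithin n (fun t => kuramotoField κ ν (fun j => x j t) i) (Ici 0) t := by
  have hu := uniqueDiffOn_Ici (0 : ℝ)
  have h1 := contDiffOn_derivWithin_of_infty hu (h.contDiffOn hm i)
  have h2 := contDiffOn_derivWithin_of_infty hu h1
  have ht' : t ∈ Ici (0 : ℝ) := ht
  rw [← iteratedDerivWithin_congr (h.derivWithin_eqOn i) ht', iteratedDerivWithin_fun_add ht' hu,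
    iteratedDerivWithin_const_mul_field]
  · simp only [timeDeriv, iteratedDerivWithin_succ']
  · exact (contDiffOn_const.mul h2 t ht').of_le (by exact_mod_cast le_top)
  · exact (h1 t ht').of_le (by exact_mod_cast le_top)

end Solutions

/-! ### Diameter, maximum norm and midrange -/

section VecDiam

variable {N : ℕ}

theorem abs_sub_le_vecDiam (x : Fin N → ℝ) (i j : Fin N) : |x i - x j| ≤ vecDiam x :=
  le_ciSup (f := fun p : Fin N × Fin N => |x p.1 - x p.2|) (finite_range _).bddAbove (i, j)

theorem vecDiam_nonneg (x : Fin N → ℝ) : 0 ≤ vecDiam x :=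
  Real.iSup_nonneg fun _ => abs_nonneg _

theorem vecDiam_le {x : Fin N → ℝ} {M : ℝ} (hN : 0 < N) (h : ∀ i j, |x i - x j| ≤ M) :
    vecDiam x ≤ M := by
  have : Nonempty (Fin N) := ⟨⟨0, hN⟩⟩
  exact ciSup_le fun p => h p.1 p.2

theorem vecDiam_lt {x : Fin N → ℝ} {M : ℝ} (hN : 0 < N) (h : ∀ i j, |x i - x j| < M) :
    vecDiam x < M := by
  have : Nonempty (Fin N) := ⟨⟨0, hN⟩⟩
  obtain ⟨p, hp⟩ := exists_eq_ciSup_of_finite (f := fun p : Fin N × Fin N => |x p.1 - x p.2|)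
  exact hp.symm.trans_lt (h p.1 p.2)

theorem vecDiam_sub_le (hN : 0 < N) (x y : Fin N → ℝ) : vecDiam (x - y) ≤ vecDiam x + vecDiam y :=
  vecDiam_le hN fun i j => by
    have h1 := abs_sub_le_vecDiam x i j
    have h2 := abs_sub_le_vecDiam y i j
    rw [Pi.sub_apply, Pi.sub_apply, show x i - y i - (x j - y j) = (x i - x j) - (y i - y j) by ring]
    exact (abs_sub _ _).trans (add_le_add h1 h2)

theorem abs_apply_le_norm (x : Fin N → ℝ) (i : Fin N) : |x i| ≤ ‖x‖ := by
  simpa using norm_le_pi_norm x i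

theorem vecDiam_le_two_mul_norm (hN : 0 < N) (x : Fin N → ℝ) : vecDiam x ≤ 2 * ‖x‖ :=
  vecDiam_le hN fun i j => by
    have h1 := abs_apply_le_norm x i
    have h2 := abs_apply_le_norm x j
    exact (abs_sub _ _).trans (by linarith)

theorem iSup_abs_eq_norm (x : Fin N → ℝ) (hN : 0 < N) : ⨆ j, |x j| = ‖x‖ := by
  have : Nonempty (Fin N) := ⟨⟨0, hN⟩⟩
  refine le_antisymm (ciSup_le (abs_apply_le_norm x)) ?_
  exact (pi_norm_le_iff_of_nonneg (Real.iSup_nonneg fun _ => abs_nonneg _)).2 fun i =>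
    le_ciSup (f := fun j => |x j|) (finite_range _).bddAbove i

theorem abs_apply_le_abs_midrange_add (x : Fin N → ℝ) (i : Fin N) :
    |x i| ≤ |((⨆ i, x i) + (⨅ i, x i)) / 2| + vecDiam x / 2 := by
  have : Nonempty (Fin N) := ⟨i⟩
  obtain ⟨a, ha⟩ := exists_eq_ciSup_of_finite (f := x)
  obtain ⟨b, hb⟩ := exists_eq_ciInf_of_finite (f := x)
  have h1 : x i ≤ ⨆ i, x i := le_ciSup (finite_range x).bddAbove i
  have h2 : ⨅ i, x i ≤ x i := ciInf_le (finite_range x).bddBelow i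
  have h3 := (le_abs_self _).trans (abs_sub_le_vecDiam x a b)
  rw [ha, hb] at h3
  have h4 := le_abs_self (((⨆ i, x i) + (⨅ i, x i)) / 2)
  have h5 := neg_abs_le (((⨆ i, x i) + (⨅ i, x i)) / 2)
  rw [abs_le]
  constructor <;> linarith

theorem abs_midrange_le_norm (x : Fin N → ℝ) (hN : 0 < N) :
    |((⨆ i, x i) + (⨅ i, x i)) / 2| ≤ ‖x‖ := by
  have : Nonempty (Fin N) := ⟨⟨0, hN⟩⟩
  obtain ⟨a, ha⟩ := exists_eq_ciSup_of_finite (f := x)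
  obtain ⟨b, hb⟩ := exists_eq_ciInf_of_finite (f := x)
  have h1 := abs_le.1 (abs_apply_le_norm x a)
  have h2 := abs_le.1 (abs_apply_le_norm x b)
  rw [← ha, ← hb, abs_le]
  constructor <;> linarith

end VecDiam

/-! ### Comparison of phases and velocities -/

section Comparison

variable {N : ℕ} {m κ : ℝ} {ν θ₀ ω₀ : Fin N → ℝ} {x y : Fin N → ℝ → ℝ}

theorem timeDeriv_zero (x : Fin N → ℝ → ℝ) (t : ℝ) (i : Fin N) : timeDeriv 0 x t i = x i t := by
  simp [timeDeriv]

theorem hasDerivWithinAt_timeDeriv (hx : ∀ i, ContDiffOn ℝ ∞ (x i) (Ici 0)) (n : ℕ) (i : Fin N)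
    {t : ℝ} (ht : 0 ≤ t) :
    HasDerivWithinAt (fun t => timeDeriv n x t i) (timeDeriv (n + 1) x t i) (Ici 0) t :=
  hasDerivWithinAt_iteratedDerivWithin (uniqueDiffOn_Ici 0) (hx i) n ht

theorem iteratedDerivWithin_phase_sub (hx : ∀ i, ContDiffOn ℝ ∞ (x i) (Ici 0)) {t : ℝ}
    (ht : 0 ≤ t) (n : ℕ) (i j : Fin N) :
    iteratedDerivWithin n (fun τ => x j τ - x i τ) (Ici 0) t =
      timeDeriv n x t j - timeDeriv n x t i :=
  iteratedDerivWithin_sub (f := x j) (g := x i) ht (uniqueDiffOn_Ici 0)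
    ((hx j t ht).of_le (by exact_mod_cast le_top)) ((hx i t ht).of_le (by exact_mod_cast le_top))

theorem hasDerivAt_exp_neg_div (m t : ℝ) :
    HasDerivAt (fun t => Real.exp (-t / m)) (-(Real.exp (-t / m) / m)) t := by
  refine ((hasDerivAt_id t).neg.div_const m).exp.congr_deriv ?_
  simp [div_eq_mul_inv]

theorem hasDerivAt_exp_two_mul (κ t : ℝ) :
    HasDerivAt (fun t => Real.exp (2 * κ * t)) (2 * κ * Real.exp (2 * κ * t)) t := by
  refine ((hasDerivAt_id t).const_mul (2 * κ)).exp.congr_deriv ?_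
  simp [mul_comm]

theorem exp_neg_div_le_one (hm : 0 < m) {t : ℝ} (ht : 0 ≤ t) : Real.exp (-t / m) ≤ 1 :=
  Real.exp_le_one_iff.2 (div_nonpos_of_nonpos_of_nonneg (by linarith) hm.le)

theorem abs_kuramotoField_pair_sub_le (hN : 0 < N) (hκ : 0 ≤ κ) (x : Fin N → ℝ) (i j : Fin N) :
    |(kuramotoField κ ν x i - ν i) - (kuramotoField κ ν x j - ν j)| ≤ 2 * κ := by
  have h1 := abs_kuramotoField_sub_le (ν := ν) hN hκ x i
  have h2 := abs_kuramotoField_sub_le (ν := ν) hN hκ x j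
  exact (abs_sub _ _).trans (by linarith)

theorem IsInertialKuramotoSolution.relaxation_zero (hm : 0 < m)
    (hx : IsInertialKuramotoSolution m κ ν θ₀ ω₀ x) {t : ℝ} (ht : 0 ≤ t) (i : Fin N) :
    m * timeDeriv 2 x t i + timeDeriv 1 x t i = kuramotoField κ ν (fun j => x j t) i := by
  simpa using hx.relaxation hm 0 ht i

theorem IsKuramotoSolution.timeDeriv_one (hy : IsKuramotoSolution κ ν θ₀ y) {t : ℝ}
    (ht : 0 ≤ t) (i : Fin N) : timeDeriv 1 y t i = kuramotoField κ ν (fun j => y j t) i := by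
  simpa using hy.timeDeriv_succ 0 ht i

/-- The forcing of x' - ω₀ is at most M + κ, and the right-hand side is the exact relaxation
response to that constant forcing from a zero initial value. -/
theorem abs_velocity_sub_init_le (hN : 0 < N) (hκ : 0 ≤ κ) (hm : 0 < m)
    (hx : IsInertialKuramotoSolution m κ ν θ₀ ω₀ x) {M : ℝ} (i : Fin N)
    (hM : |ω₀ i - ν i| ≤ M) {t : ℝ} (ht : 0 ≤ t) :
    |timeDeriv 1 x t i - ω₀ i| ≤ (M + κ) * (1 - Real.exp (-t / m)) := by
  refine abs_le_of_relaxation hm (f := fun t => timeDeriv 1 x t i - ω₀ i)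
    (B := fun t => (M + κ) * (1 - Real.exp (-t / m)))
    (fun t ht => (hasDerivWithinAt_timeDeriv (hx.contDiffOn hm) 1 i ht).sub_const _)
    (fun t => ((hasDerivAt_exp_neg_div m t).const_sub 1).const_mul _)
    (by simp [hx.init_vel]) (fun t ht => ?_) ht
  have h1 := abs_kuramotoField_sub_le (ν := ν) hN hκ (fun j => x j t) i
  rw [show m * timeDeriv (1 + 1) x t i + (timeDeriv 1 x t i - ω₀ i) =
    (kuramotoField κ ν (fun j => x j t) i - ν i) - (ω₀ i - ν i) by
      rw [← hx.relaxation_zero hm ht i]; ring]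
  refine (abs_sub _ _).trans (le_trans (by linarith : _ ≤ M + κ) (le_of_eq ?_))
  field_simp
  ring

theorem abs_velocity_pair_sub_init_le (hN : 0 < N) (hκ : 0 ≤ κ) (hm : 0 < m)
    (hx : IsInertialKuramotoSolution m κ ν θ₀ ω₀ x) (i j : Fin N) {t : ℝ} (ht : 0 ≤ t) :
    |(timeDeriv 1 x t i - ω₀ i) - (timeDeriv 1 x t j - ω₀ j)| ≤
      (vecDiam (ω₀ - ν) + 2 * κ) * (1 - Real.exp (-t / m)) := by
  refine abs_le_of_relaxation hm
    (f := fun t => (timeDeriv 1 x t i - ω₀ i) - (timeDeriv 1 x t j - ω₀ j))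
    (B := fun t => (vecDiam (ω₀ - ν) + 2 * κ) * (1 - Real.exp (-t / m)))
    (fun t ht => ((hasDerivWithinAt_timeDeriv (hx.contDiffOn hm) 1 i ht).sub_const _).sub
      ((hasDerivWithinAt_timeDeriv (hx.contDiffOn hm) 1 j ht).sub_const _))
    (fun t => ((hasDerivAt_exp_neg_div m t).const_sub 1).const_mul _)
    (by simp [hx.init_vel]) (fun t ht => ?_) ht
  have h1 := abs_kuramotoField_pair_sub_le (ν := ν) hN hκ (fun j => x j t) i j
  have h2 := abs_sub_le_vecDiam (ω₀ - ν) i j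
  simp only [Pi.sub_apply] at h2
  rw [show m * (timeDeriv (1 + 1) x t i - timeDeriv (1 + 1) x t j) +
      ((timeDeriv 1 x t i - ω₀ i) - (timeDeriv 1 x t j - ω₀ j)) =
    ((kuramotoField κ ν (fun j => x j t) i - ν i) - (kuramotoField κ ν (fun j => x j t) j - ν j))
      - ((ω₀ i - ν i) - (ω₀ j - ν j)) by
      rw [← hx.relaxation_zero hm ht i, ← hx.relaxation_zero hm ht j]; ring]
  refine (abs_sub _ _).trans (le_trans (by linarith : _ ≤ vecDiam (ω₀ - ν) + 2 * κ) (le_of_eq ?_))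
  field_simp
  ring

/-- Adding m(x' - ω₀) absorbs the inertial term, so a first-order Grönwall or integration argument
applies; subtracting ω₀ makes the combination vanish at t = 0. -/
theorem hasDerivWithinAt_modified_difference (hm : 0 < m)
    (hx : IsInertialKuramotoSolution m κ ν θ₀ ω₀ x) (hy : IsKuramotoSolution κ ν θ₀ y)
    (i : Fin N) {t : ℝ} (ht : 0 ≤ t) :
    HasDerivWithinAt (fun t => x i t - y i t + m * (timeDeriv 1 x t i - ω₀ i))
      (kuramotoField κ ν (fun j => x j t) i - kuramotoField κ ν (fun j => y j t) i) (Ici 0) t := by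
  have h0 := hasDerivWithinAt_timeDeriv (hx.contDiffOn hm) 0 i ht
  have h1 := hasDerivWithinAt_timeDeriv (hx.contDiffOn hm) 1 i ht
  have h2 := hasDerivWithinAt_timeDeriv hy.contDiffOn 0 i ht
  simp only [timeDeriv_zero] at h0 h2
  refine ((h0.sub h2).add ((h1.sub_const (ω₀ i)).const_mul m)).congr_deriv ?_
  rw [← hx.relaxation_zero hm ht i, ← hy.timeDeriv_one ht i]
  simp only [zero_add, Nat.reduceAdd]
  ring

/-- Grönwall estimate for the diameter of the difference of the phases. -/
theorem abs_phase_pair_sub_le (hN : 0 < N) (hκ : 0 < κ) (hm : 0 < m)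
    (hx : IsInertialKuramotoSolution m κ ν θ₀ ω₀ x) (hy : IsKuramotoSolution κ ν θ₀ y)
    (i j : Fin N) {T : ℝ} (hT : 0 ≤ T) :
    |(x i T - y i T) - (x j T - y j T)| ≤
      m * (vecDiam (ω₀ - ν) + 2 * κ) * (1 - Real.exp (-T / m)) * Real.exp (2 * κ * T) := by
  set ζ : ℝ → Fin N → ℝ := fun t i => x i t - y i t + m * (timeDeriv 1 x t i - ω₀ i) with hζ
  set η := m * (vecDiam (ω₀ - ν) + 2 * κ) * (1 - Real.exp (-T / m)) with hη
  have hd : 0 ≤ vecDiam (ω₀ - ν) := vecDiam_nonneg _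
  have hη0 : 0 ≤ η := mul_nonneg (by positivity) (by linarith [exp_neg_div_le_one hm hT])
  have hclose : ∀ t ∈ Icc (0 : ℝ) T, ∀ i j,
      |(x i t - y i t) - (x j t - y j t)| ≤ |ζ t i - ζ t j| + η := by
    intro t ht i j
    have h1 := abs_velocity_pair_sub_init_le hN hκ.le hm hx i j ht.1
    have h2 : Real.exp (-T / m) ≤ Real.exp (-t / m) := by
      gcongr
      exact ht.2
    have h3 : |m * ((timeDeriv 1 x t i - ω₀ i) - (timeDeriv 1 x t j - ω₀ j))| ≤ η := by
      rw [abs_mul, abs_of_pos hm, hη, mul_assoc]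
      gcongr
      refine h1.trans ?_
      gcongr
    rw [show (x i t - y i t) - (x j t - y j t) = (ζ t i - ζ t j) -
      m * ((timeDeriv 1 x t i - ω₀ i) - (timeDeriv 1 x t j - ω₀ j)) by simp only [hζ]; ring]
    exact (abs_sub _ _).trans (by linarith)
  -- Indexing by pairs makes the sup norm of the vector equal to the diameter of ζ, so the
  -- normed-space Grönwall inequality applies directly.
  have hder : ∀ t ∈ Ici (0 : ℝ), HasDerivWithinAt
      (fun t => fun p : Fin N × Fin N => ζ t p.1 - ζ t p.2)
      (fun p : Fin N × Fin N =>
        (kuramotoField κ ν (fun j => x j t) p.1 - kuramotoField κ ν (fun j => y j t) p.1) -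
        (kuramotoField κ ν (fun j => x j t) p.2 - kuramotoField κ ν (fun j => y j t) p.2))
      (Ici 0) t := fun t ht => hasDerivWithinAt_pi.2 fun p =>
    (hasDerivWithinAt_modified_difference hm hx hy p.1 ht).sub
      (hasDerivWithinAt_modified_difference hm hx hy p.2 ht)
  have hpair : ∀ (t : ℝ) (i j : Fin N),
      |ζ t i - ζ t j| ≤ ‖fun p : Fin N × Fin N => ζ t p.1 - ζ t p.2‖ := fun t i j => by
    simpa using norm_le_pi_norm (fun p : Fin N × Fin N => ζ t p.1 - ζ t p.2) (i, j)
  -- With K = 2κ and ε = 2κη the bound is η(e^{2κT} - 1); the η lost in returning from ζ to the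
  -- phases restores exactly η e^{2κT}. Taking η at the endpoint T is legitimate because 1 -
  -- e^{-t/m} increases.
  have key := norm_le_gronwallBound_of_norm_deriv_right_le (a := 0) (b := T) (δ := 0) (K := 2 * κ)
    (ε := 2 * κ * η)
    (fun t ht => (hder t ht.1).continuousWithinAt.mono Icc_subset_Ici_self)
    (fun t ht => (hder t ht.1).mono (Ici_subset_Ici.2 ht.1))
    (by simp [hζ, hx.init_pos, hy.init_pos, hx.init_vel, Pi.zero_def])
    (fun t ht => by
      refine (pi_norm_le_iff_of_nonneg (by positivity)).2 fun p => ?_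
      have hM := abs_kuramotoField_sub_kuramotoField_le (ν := ν) hN hκ.le
        (x := fun j => x j t) (y := fun j => y j t)
        (fun i j => (hclose t ⟨ht.1, ht.2.le⟩ i j).trans (add_le_add_left (hpair t i j) η))
      exact (abs_sub _ _).trans ((add_le_add (hM p.1) (hM p.2)).trans (le_of_eq (by ring))))
    T (right_mem_Icc.2 hT)
  rw [gronwallBound_of_K_ne_0 (by positivity)] at key
  have h1 := hclose T (right_mem_Icc.2 hT) i j
  have h2 := (hpair T i j).trans key
  have h3 : 2 * κ * η / (2 * κ) = η := by field_simp
  simp only [h3, zero_mul, zero_add, sub_zero] at h2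
  linarith

theorem abs_phase_pair_sub_lt (hN : 0 < N) (hκ : 0 < κ) (hm : 0 < m)
    (hx : IsInertialKuramotoSolution m κ ν θ₀ ω₀ x) (hy : IsKuramotoSolution κ ν θ₀ y)
    (i j : Fin N) {t : ℝ} (ht : 0 ≤ t) :
    |(x i t - y i t) - (x j t - y j t)| <
      m * (vecDiam (ω₀ - ν) + 2 * κ) * Real.exp (2 * κ * t) := by
  refine (abs_phase_pair_sub_le hN hκ hm hx hy i j ht).trans_lt ?_
  have hd : 0 ≤ vecDiam (ω₀ - ν) := vecDiam_nonneg _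
  have := Real.exp_pos (-t / m)
  have hp : 0 < m * (vecDiam (ω₀ - ν) + 2 * κ) := by positivity
  exact mul_lt_mul_of_pos_right (mul_lt_of_lt_one_right hp (by linarith)) (Real.exp_pos _)

/-- The pair estimate bounds the derivative of the modified difference, whose integral carries the
factor e^{2κt} - 1. The correction m(x' - ω₀) costs m times midrange plus half-diameter plus κ, and
the last two cancel the -1. -/
theorem abs_phase_sub_lt (hN : 0 < N) (hκ : 0 < κ) (hm : 0 < m)
    (hx : IsInertialKuramotoSolution m κ ν θ₀ ω₀ x) (hy : IsKuramotoSolution κ ν θ₀ y)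
    (i : Fin N) {t : ℝ} (ht : 0 ≤ t) :
    |x i t - y i t| < m * |((⨆ i, (ω₀ i - ν i)) + (⨅ i, (ω₀ i - ν i))) / 2|
      + 1 / 2 * m * (vecDiam (ω₀ - ν) + 2 * κ) * Real.exp (2 * κ * t) := by
  have hd : 0 ≤ vecDiam (ω₀ - ν) := vecDiam_nonneg _
  have h1 : |x i t - y i t + m * (timeDeriv 1 x t i - ω₀ i)| ≤
      1 / 2 * m * (vecDiam (ω₀ - ν) + 2 * κ) * (Real.exp (2 * κ * t) - 1) := by
    refine image_norm_le_of_norm_deriv_right_le_deriv_boundary (a := 0) (b := t)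
      (B := fun t => 1 / 2 * m * (vecDiam (ω₀ - ν) + 2 * κ) * (Real.exp (2 * κ * t) - 1))
      (fun s hs => (hasDerivWithinAt_modified_difference hm hx hy i hs.1).continuousWithinAt.mono
        Icc_subset_Ici_self)
      (fun s hs => (hasDerivWithinAt_modified_difference hm hx hy i hs.1).mono
        (Ici_subset_Ici.2 hs.1))
      (by simp [hx.init_pos, hy.init_pos, hx.init_vel])
      (fun s => ((hasDerivAt_exp_two_mul κ s).sub_const 1).const_mul _)
      (fun s hs => ?_) (right_mem_Icc.2 ht)
    have := abs_kuramotoField_sub_kuramotoField_le (ν := ν) hN hκ.le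
        (x := fun j => x j s) (y := fun j => y j s)
        (fun i j => (abs_phase_pair_sub_lt hN hκ hm hx hy i j hs.1).le) i
    exact this.trans (le_of_eq (by ring))
  have h2 := abs_velocity_sub_init_le hN hκ.le hm hx i
    (abs_apply_le_abs_midrange_add (ω₀ - ν) i) ht
  simp only [Pi.sub_apply] at h2
  set c := |((⨆ i, (ω₀ i - ν i)) + (⨅ i, (ω₀ i - ν i))) / 2|
  have hc : 0 ≤ c := abs_nonneg _
  have h3 : |m * (timeDeriv 1 x t i - ω₀ i)| < m * (c + vecDiam (ω₀ - ν) / 2 + κ) := by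
    rw [abs_mul, abs_of_pos hm]
    gcongr
    have := Real.exp_pos (-t / m)
    exact h2.trans_lt (mul_lt_of_lt_one_right (by positivity) (by linarith))
  have h4 := abs_sub (x i t - y i t + m * (timeDeriv 1 x t i - ω₀ i))
    (m * (timeDeriv 1 x t i - ω₀ i))
  rw [add_sub_cancel_right] at h4
  linarith

theorem norm_phase_sub_lt (hN : 0 < N) (hκ : 0 < κ) (hm : 0 < m)
    (hx : IsInertialKuramotoSolution m κ ν θ₀ ω₀ x) (hy : IsKuramotoSolution κ ν θ₀ y)
    {t : ℝ} (ht : 0 ≤ t) :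
    ‖(fun i => x i t - y i t)‖ < m * |((⨆ i, (ω₀ i - ν i)) + (⨅ i, (ω₀ i - ν i))) / 2|
      + 1 / 2 * m * (vecDiam (ω₀ - ν) + 2 * κ) * Real.exp (2 * κ * t) := by
  have hd : 0 ≤ vecDiam (ω₀ - ν) := vecDiam_nonneg _
  exact (pi_norm_lt_iff (by positivity)).2 fun i => abs_phase_sub_lt hN hκ hm hx hy i ht

theorem vecDiam_phase_sub_lt (hN : 0 < N) (hκ : 0 < κ) (hm : 0 < m)
    (hx : IsInertialKuramotoSolution m κ ν θ₀ ω₀ x) (hy : IsKuramotoSolution κ ν θ₀ y)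
    {t : ℝ} (ht : 0 ≤ t) :
    vecDiam (fun i => x i t - y i t) < m * (vecDiam (ω₀ - ν) + 2 * κ) * Real.exp (2 * κ * t) :=
  vecDiam_lt hN fun i j => abs_phase_pair_sub_lt hN hκ hm hx hy i j ht

theorem abs_phase_sub_le (hN : 0 < N) (hκ : 0 < κ) (hm : 0 < m)
    (hx : IsInertialKuramotoSolution m κ ν θ₀ ω₀ x) (hy : IsKuramotoSolution κ ν θ₀ y)
    (i : Fin N) {t : ℝ} (ht : 0 ≤ t) :
    |x i t - y i t| ≤ m * (2 * (⨆ j, |ω₀ j - ν j|) + κ) * Real.exp (2 * κ * t) := by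
  have h1 := (abs_phase_sub_lt hN hκ hm hx hy i ht).le
  have h2 := abs_midrange_le_norm (ω₀ - ν) hN
  have h3 := vecDiam_le_two_mul_norm hN (ω₀ - ν)
  have h4 := iSup_abs_eq_norm (ω₀ - ν) hN
  simp only [Pi.sub_apply] at h2 h4
  rw [h4]
  have h5 : 1 ≤ Real.exp (2 * κ * t) := Real.one_le_exp (by positivity)
  calc |x i t - y i t| ≤ _ := h1
    _ ≤ m * ‖ω₀ - ν‖ + 1 / 2 * m * (2 * ‖ω₀ - ν‖ + 2 * κ) * Real.exp (2 * κ * t) := by gcongr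
    _ ≤ m * ‖ω₀ - ν‖ * Real.exp (2 * κ * t) +
        1 / 2 * m * (2 * ‖ω₀ - ν‖ + 2 * κ) * Real.exp (2 * κ * t) := by
        gcongr ?_ + _
        exact le_mul_of_one_le_right (by positivity) h5
    _ = _ := by ring

theorem abs_kuramotoField_derivWithin_le (hN : 0 < N) (hκ : 0 ≤ κ)
    (hy : ∀ i, ContDiffOn ℝ ∞ (y i) (Ici 0)) {t M : ℝ} (ht : 0 ≤ t)
    (h : ∀ i j, |timeDeriv 1 y t i - timeDeriv 1 y t j| ≤ M) (i : Fin N) :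
    |iteratedDerivWithin 1 (fun t => kuramotoField κ ν (fun j => y j t) i) (Ici 0) t| ≤ κ * M := by
  refine abs_iteratedDerivWithin_kuramotoField_le hN hκ (uniqueDiffOn_Ici 0) hy one_pos ht
    (fun i j => ?_) i
  have hu := uniqueDiffOn_Ici (0 : ℝ)
  rw [show (1 : ℕ) = 0 + 1 from rfl, iteratedDerivWithin_succ_sin_add hu ((hy j).sub (hy i)) ht]
  simp only [zero_add, Finset.range_one, Finset.sum_singleton, Nat.choose_self, Nat.cast_one,
    one_mul, tsub_self, iteratedDerivWithin_zero, abs_mul, iteratedDerivWithin_phase_sub hy ht]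
  exact (mul_le_of_le_one_right (abs_nonneg _) (Real.abs_sin_le_one _)).trans (h j i)

theorem abs_timeDeriv_one_pair_le (hN : 0 < N) (hκ : 0 ≤ κ) (hy : IsKuramotoSolution κ ν θ₀ y)
    (i j : Fin N) {t : ℝ} (ht : 0 ≤ t) :
    |timeDeriv 1 y t i - timeDeriv 1 y t j| ≤ vecDiam ν + 2 * κ := by
  rw [hy.timeDeriv_one ht, hy.timeDeriv_one ht]
  have h1 := abs_kuramotoField_pair_sub_le (ν := ν) hN hκ (fun j => y j t) i j
  have h2 := abs_sub_le_vecDiam ν i j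
  calc _ = |((kuramotoField κ ν (fun j => y j t) i - ν i) -
        (kuramotoField κ ν (fun j => y j t) j - ν j)) + (ν i - ν j)| := by congr 1; ring
    _ ≤ _ := (abs_add_le _ _).trans (by linarith)

theorem abs_timeDeriv_two_le (hN : 0 < N) (hκ : 0 ≤ κ) (hy : IsKuramotoSolution κ ν θ₀ y)
    (i : Fin N) {t : ℝ} (ht : 0 ≤ t) :
    |timeDeriv 2 y t i| ≤ κ * (vecDiam ν + 2 * κ) := by
  rw [hy.timeDeriv_succ 1 ht]
  exact abs_kuramotoField_derivWithin_le hN hκ hy.contDiffOn ht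
    (fun i j => abs_timeDeriv_one_pair_le hN hκ hy i j ht) i

/-- The first-order solution obeys the inertial equation up to the defect m y^(n+2), a forcing of
size m since derivatives of y are bounded independently of m. -/
theorem relaxation_difference (hm : 0 < m)
    (hx : IsInertialKuramotoSolution m κ ν θ₀ ω₀ x) (hy : IsKuramotoSolution κ ν θ₀ y)
    (n : ℕ) (i : Fin N) {t : ℝ} (ht : 0 ≤ t) :
    m * (timeDeriv (n + 2) x t i - timeDeriv (n + 2) y t i) +
        (timeDeriv (n + 1) x t i - timeDeriv (n + 1) y t i) =
      (iteratedDerivWithin n (fun t => kuramotoField κ ν (fun j => x j t) i) (Ici 0) t -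
        iteratedDerivWithin n (fun t => kuramotoField κ ν (fun j => y j t) i) (Ici 0) t) -
        m * timeDeriv (n + 2) y t i := by
  rw [← hx.relaxation hm n ht, ← hy.timeDeriv_succ n ht]
  ring

/-- The comparison function for the first derivatives. -/
theorem hasDerivAt_velocity_majorant (a b c m κ t : ℝ) :
    HasDerivAt (fun t => a * Real.exp (-t / m) + b * (1 - Real.exp (-t / m)) +
        c * Real.exp (2 * κ * t) * (1 - Real.exp (-t / m)))
      (a * -(Real.exp (-t / m) / m) + b * -(-(Real.exp (-t / m) / m)) +
        (c * (2 * κ * Real.exp (2 * κ * t)) * (1 - Real.exp (-t / m)) +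
          c * Real.exp (2 * κ * t) * -(-(Real.exp (-t / m) / m)))) t :=
  (((hasDerivAt_exp_neg_div m t).const_mul a).add
    (((hasDerivAt_exp_neg_div m t).const_sub 1).const_mul b)).add
    (((hasDerivAt_exp_two_mul κ t).const_mul c).mul ((hasDerivAt_exp_neg_div m t).const_sub 1))

/-- Applying m d/dt + 1 gives b + c e^{2κt} plus a nonnegative term from differentiating e^{2κt}.
Thus a pays for the initial value, b for the defect, and c for the difference of fields. -/
theorem velocity_majorant_relaxation {a b c t : ℝ} (hm : 0 < m) (hκ : 0 ≤ κ) (hc : 0 ≤ c)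
    (ht : 0 ≤ t) :
    b + c * Real.exp (2 * κ * t) * (1 - Real.exp (-t / m)) ≤
      m * (a * -(Real.exp (-t / m) / m) + b * -(-(Real.exp (-t / m) / m)) +
        (c * (2 * κ * Real.exp (2 * κ * t)) * (1 - Real.exp (-t / m)) +
          c * Real.exp (2 * κ * t) * -(-(Real.exp (-t / m) / m)))) +
      (a * Real.exp (-t / m) + b * (1 - Real.exp (-t / m)) +
        c * Real.exp (2 * κ * t) * (1 - Real.exp (-t / m))) := by
  have h1 := exp_neg_div_le_one hm ht
  have h2 : 0 ≤ m * c * (2 * κ * Real.exp (2 * κ * t)) * (1 - Real.exp (-t / m)) :=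
    mul_nonneg (by positivity) (by linarith)
  have h3 : 0 ≤ c * Real.exp (2 * κ * t) * Real.exp (-t / m) := by positivity
  have h4 : m * (Real.exp (-t / m) / m) = Real.exp (-t / m) := by field_simp
  linear_combination h2 + h3 + (a - b - c * Real.exp (2 * κ * t)) * h4

theorem velocity_majorant_lt {a b c t : ℝ} (hb : 0 < b) (hc : 0 ≤ c) :
    a * Real.exp (-t / m) + b * (1 - Real.exp (-t / m)) +
      c * Real.exp (2 * κ * t) * (1 - Real.exp (-t / m)) <
    a * Real.exp (-t / m) + b + c * Real.exp (2 * κ * t) := by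
  have h1 := mul_pos hb (Real.exp_pos (-t / m))
  have h2 : 0 ≤ c * Real.exp (2 * κ * t) * Real.exp (-t / m) := by positivity
  linarith

theorem abs_velocity_sub_lt (hN : 0 < N) (hκ : 0 < κ) (hm : 0 < m)
    (hx : IsInertialKuramotoSolution m κ ν θ₀ ω₀ x) (hy : IsKuramotoSolution κ ν θ₀ y)
    (i : Fin N) {t : ℝ} (ht : 0 ≤ t) :
    |timeDeriv 1 x t i - timeDeriv 1 y t i| <
      (‖ω₀ - ν‖ + κ) * Real.exp (-t / m) + m * κ * (vecDiam ν + 2 * κ)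
        + m * κ * (vecDiam (ω₀ - ν) + 2 * κ) * Real.exp (2 * κ * t) := by
  have hd : 0 ≤ vecDiam (ω₀ - ν) := vecDiam_nonneg _
  have hd' : 0 ≤ vecDiam ν := vecDiam_nonneg _
  refine (abs_le_of_relaxation hm (f := fun t => timeDeriv 1 x t i - timeDeriv 1 y t i)
    (fun t ht => (hasDerivWithinAt_timeDeriv (hx.contDiffOn hm) 1 i ht).sub
      (hasDerivWithinAt_timeDeriv hy.contDiffOn 1 i ht))
    (hasDerivAt_velocity_majorant (‖ω₀ - ν‖ + κ) (m * κ * (vecDiam ν + 2 * κ))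
      (m * κ * (vecDiam (ω₀ - ν) + 2 * κ)) m κ) ?_ (fun t ht => ?_) ht).trans_lt
    (velocity_majorant_lt (by positivity) (by positivity))
  · have h1 := abs_kuramotoField_sub_le (ν := ν) hN hκ.le (fun j => y j 0) i
    have h2 := abs_apply_le_norm (ω₀ - ν) i
    simp only [Pi.sub_apply] at h2
    simp only [hx.init_vel, hy.timeDeriv_one le_rfl, neg_zero, zero_div, Real.exp_zero, sub_self,
      mul_zero, add_zero, mul_one]
    calc _ = |(ω₀ i - ν i) - (kuramotoField κ ν (fun j => y j 0) i - ν i)| := by congr 1; ring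
      _ ≤ _ := (abs_sub _ _).trans (by linarith)
  · refine le_trans ?_ (velocity_majorant_relaxation hm hκ.le (by positivity) ht)
    rw [relaxation_difference hm hx hy 0 i ht]
    have h1 := abs_kuramotoField_sub_kuramotoField_le (ν := ν) hN hκ.le
        (x := fun j => x j t) (y := fun j => y j t)
        (fun i j => abs_phase_pair_sub_le hN hκ hm hx hy i j ht) i
    have h2 := mul_le_mul_of_nonneg_left (abs_timeDeriv_two_le hN hκ.le hy i ht) hm.le
    rw [← abs_of_pos hm, ← abs_mul, abs_of_pos hm] at h2
    simp only [iteratedDerivWithin_zero, zero_add]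
    exact (abs_sub _ _).trans (by linarith)

theorem abs_velocity_pair_sub_lt (hN : 0 < N) (hκ : 0 < κ) (hm : 0 < m)
    (hx : IsInertialKuramotoSolution m κ ν θ₀ ω₀ x) (hy : IsKuramotoSolution κ ν θ₀ y)
    (i j : Fin N) {t : ℝ} (ht : 0 ≤ t) :
    |(timeDeriv 1 x t i - timeDeriv 1 y t i) - (timeDeriv 1 x t j - timeDeriv 1 y t j)| <
      (vecDiam (ω₀ - ν) + 2 * κ) * Real.exp (-t / m) + 2 * m * κ * (vecDiam ν + 2 * κ)
        + 2 * m * κ * (vecDiam (ω₀ - ν) + 2 * κ) * Real.exp (2 * κ * t) := by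
  have hd : 0 ≤ vecDiam (ω₀ - ν) := vecDiam_nonneg _
  have hd' : 0 ≤ vecDiam ν := vecDiam_nonneg _
  refine (abs_le_of_relaxation hm
    (f := fun t => (timeDeriv 1 x t i - timeDeriv 1 y t i) -
      (timeDeriv 1 x t j - timeDeriv 1 y t j))
    (fun t ht => ((hasDerivWithinAt_timeDeriv (hx.contDiffOn hm) 1 i ht).sub
      (hasDerivWithinAt_timeDeriv hy.contDiffOn 1 i ht)).sub
      ((hasDerivWithinAt_timeDeriv (hx.contDiffOn hm) 1 j ht).sub
      (hasDerivWithinAt_timeDeriv hy.contDiffOn 1 j ht)))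
    (hasDerivAt_velocity_majorant (vecDiam (ω₀ - ν) + 2 * κ) (2 * m * κ * (vecDiam ν + 2 * κ))
      (2 * m * κ * (vecDiam (ω₀ - ν) + 2 * κ)) m κ) ?_ (fun t ht => ?_) ht).trans_lt
    (velocity_majorant_lt (by positivity) (by positivity))
  · have h1 := abs_kuramotoField_pair_sub_le (ν := ν) hN hκ.le (fun j => y j 0) i j
    have h2 := abs_sub_le_vecDiam (ω₀ - ν) i j
    simp only [Pi.sub_apply] at h2
    simp only [hx.init_vel, hy.timeDeriv_one le_rfl, neg_zero, zero_div, Real.exp_zero, sub_self,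
      mul_zero, add_zero, mul_one]
    calc _ = |((ω₀ i - ν i) - (ω₀ j - ν j)) - ((kuramotoField κ ν (fun j => y j 0) i - ν i) -
          (kuramotoField κ ν (fun j => y j 0) j - ν j))| := by congr 1; ring
      _ ≤ _ := (abs_sub _ _).trans (by linarith)
  · refine le_trans ?_ (velocity_majorant_relaxation hm hκ.le (by positivity) ht)
    have e1 := relaxation_difference hm hx hy 0 i ht
    have e2 := relaxation_difference hm hx hy 0 j ht
    have h1 := abs_kuramotoField_sub_kuramotoField_le (ν := ν) hN hκ.le
        (x := fun j => x j t) (y := fun j => y j t)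
        (fun i j => abs_phase_pair_sub_le hN hκ hm hx hy i j ht)
    have h2 : ∀ i, |m * timeDeriv 2 y t i| ≤ m * (κ * (vecDiam ν + 2 * κ)) := fun i => by
      rw [abs_mul, abs_of_pos hm]
      exact mul_le_mul_of_nonneg_left (abs_timeDeriv_two_le hN hκ.le hy i ht) hm.le
    simp only [iteratedDerivWithin_zero, zero_add] at e1 e2
    have a1 := (abs_le.1 (h1 i))
    have a2 := (abs_le.1 (h1 j))
    have a3 := (abs_le.1 (h2 i))
    have a4 := (abs_le.1 (h2 j))
    simp only [Nat.reduceAdd]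
    rw [abs_le]
    constructor <;> linarith

end Comparison

/-! ### Layer and bulk majorants -/

/-- The majorant of the initial layer. -/
noncomputable def layerMajorant (P m : ℝ) (n : ℕ) (t : ℝ) : ℝ := (P * (1 + t / m)) ^ n * Real.exp (-t / m)

/-- The majorant away from the initial layer. -/
noncomputable def bulkMajorant (A m : ℝ) (n : ℕ) (t : ℝ) : ℝ := A ^ n * (1 - Real.exp (-t / m))

section Majorants

variable {A P m t : ℝ}

theorem layerMajorant_nonneg (hm : 0 < m) (hP : 0 ≤ P) (ht : 0 ≤ t) (n : ℕ) :
    0 ≤ layerMajorant P m n t := by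
  unfold layerMajorant; positivity

theorem bulkMajorant_nonneg (hm : 0 < m) (hA : 0 ≤ A) (ht : 0 ≤ t) (n : ℕ) :
    0 ≤ bulkMajorant A m n t :=
  mul_nonneg (by positivity) (by linarith [exp_neg_div_le_one hm ht])

theorem bulkMajorant_le (hA : 0 ≤ A) (n : ℕ) : bulkMajorant A m n t ≤ A ^ n :=
  mul_le_of_le_one_right (by positivity) (by linarith [Real.exp_pos (-t / m)])

theorem layerMajorant_at_zero (n : ℕ) : layerMajorant P m n 0 = P ^ n := by
  simp [layerMajorant]

theorem bulkMajorant_at_zero (n : ℕ) : bulkMajorant A m n 0 = 0 := by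
  simp [bulkMajorant]

theorem layerMajorant_add_bulkMajorant_zero :
    layerMajorant P m 0 t + bulkMajorant A m 0 t = 1 := by
  simp [layerMajorant, bulkMajorant]

theorem le_mul_one_add_div (hm : 0 < m) (hA : 0 ≤ A) (hAP : A ≤ P) (ht : 0 ≤ t) :
    A ≤ P * (1 + t / m) := by
  have : 0 ≤ P * (t / m) := mul_nonneg (hA.trans hAP) (by positivity)
  linarith

/-- With X = P(1+t/m) ≥ A, layer plus bulk is the k-th moment of a variable equal to X with
probability e^{-t/m} and to A otherwise. Both powers increase with the variable, so their covariance
e(1-e)(X^k - A^k)(X^l - A^l), where e = e^{-t/m}, is nonnegative. -/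
theorem majorant_mul_majorant_le (hm : 0 < m) (hA : 0 ≤ A) (hAP : A ≤ P) (ht : 0 ≤ t) (k l : ℕ) :
    (layerMajorant P m k t + bulkMajorant A m k t) *
      (layerMajorant P m l t + bulkMajorant A m l t) ≤
      layerMajorant P m (k + l) t + bulkMajorant A m (k + l) t := by
  have hX := le_mul_one_add_div hm hA hAP ht
  have he := exp_neg_div_le_one hm ht
  have he' := Real.exp_pos (-t / m)
  unfold layerMajorant bulkMajorant
  generalize P * (1 + t / m) = X at *
  generalize Real.exp (-t / m) = e at *
  have h1 : 0 ≤ X ^ k - A ^ k := sub_nonneg.2 (by gcongr)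
  have h2 : 0 ≤ X ^ l - A ^ l := sub_nonneg.2 (by gcongr)
  have h3 : 0 ≤ e * (1 - e) * ((X ^ k - A ^ k) * (X ^ l - A ^ l)) :=
    mul_nonneg (mul_nonneg he'.le (by linarith)) (mul_nonneg h1 h2)
  rw [pow_add, pow_add]
  linarith

theorem majorant_le_pow (hm : 0 < m) (hA : 0 ≤ A) (hAP : A ≤ P) (ht : 0 ≤ t) (k : ℕ) :
    layerMajorant P m k t + bulkMajorant A m k t ≤ (P * (1 + t / m)) ^ k := by
  have hX := le_mul_one_add_div hm hA hAP ht
  have he := exp_neg_div_le_one hm ht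
  unfold layerMajorant bulkMajorant
  generalize P * (1 + t / m) = X at *
  have h1 : 0 ≤ X ^ k - A ^ k := sub_nonneg.2 (by gcongr)
  have h2 := mul_nonneg h1 (sub_nonneg.2 he)
  linarith

theorem layerMajorant_mul_majorant_le (hm : 0 < m) (hA : 0 ≤ A) (hAP : A ≤ P) (ht : 0 ≤ t)
    (k l : ℕ) :
    layerMajorant P m k t * (layerMajorant P m l t + bulkMajorant A m l t) ≤
      layerMajorant P m (k + l) t := by
  refine (mul_le_mul_of_nonneg_left (majorant_le_pow hm hA hAP ht l)
    (layerMajorant_nonneg hm (hA.trans hAP) ht k)).trans (le_of_eq ?_)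
  unfold layerMajorant
  ring

theorem pow_mul_layerMajorant_le (hm : 0 < m) (hA : 0 ≤ A) (hAP : A ≤ P) (ht : 0 ≤ t)
    (k l : ℕ) : A ^ k * layerMajorant P m l t ≤ layerMajorant P m (k + l) t := by
  have hX := le_mul_one_add_div hm hA hAP ht
  unfold layerMajorant
  rw [pow_add, ← mul_assoc]
  gcongr
  exact pow_nonneg (hA.trans hX) _

theorem pow_mul_bulkMajorant (k l : ℕ) :
    A ^ k * bulkMajorant A m l t = bulkMajorant A m (k + l) t := by
  unfold bulkMajorant
  ring

theorem pow_mul_majorant_le (hm : 0 < m) (hA : 0 ≤ A) (hAP : A ≤ P) (ht : 0 ≤ t)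
    (k l : ℕ) : A ^ k * (layerMajorant P m l t + bulkMajorant A m l t) ≤
      layerMajorant P m (k + l) t + bulkMajorant A m (k + l) t := by
  rw [mul_add, pow_mul_bulkMajorant]
  exact add_le_add_left (pow_mul_layerMajorant_le hm hA hAP ht k l) _

/-- Equivalently, m d/dt + 1 lowers the order by one and yields (n+1)P times the layer of order n.
The factor 1 + t/m is there for this: it absorbs forcing resonant with e^{-t/m}. -/
theorem hasDerivAt_layerMajorant (n : ℕ) (t : ℝ) :
    HasDerivAt (layerMajorant P m (n + 1))
      (((n + 1) * P * layerMajorant P m n t - layerMajorant P m (n + 1) t) / m) t := by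
  have h := (((((hasDerivAt_id t).div_const m).const_add 1).const_mul P).pow (n + 1)).mul
    (hasDerivAt_exp_neg_div m t)
  refine h.congr_deriv ?_
  simp only [layerMajorant, id, Pi.pow_apply, add_tsub_cancel_right, Nat.cast_add, Nat.cast_one]
  ring

theorem hasDerivAt_bulkMajorant (n : ℕ) (t : ℝ) :
    HasDerivAt (bulkMajorant A m n) ((A ^ n - bulkMajorant A m n t) / m) t := by
  refine (((hasDerivAt_exp_neg_div m t).const_sub 1).const_mul (A ^ n)).congr_deriv ?_
  unfold bulkMajorant
  ring

end Majorants

/-! ### A priori bounds for the first-order model -/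

section Bounds

variable {N : ℕ} {m κ A P : ℝ} {ν θ₀ ω₀ : Fin N → ℝ} {x y : Fin N → ℝ → ℝ}

theorem abs_sin_phase_le_of_bound (hx : ∀ i, ContDiffOn ℝ ∞ (x i) (Ici 0)) {t : ℝ} (ht : 0 ≤ t)
    {G : ℕ → ℝ} (hG0 : 1 ≤ G 0) (hG : ∀ k, 0 ≤ G k)
    (hmul : ∀ k l, G k * G l ≤ G (k + l)) (n : ℕ)
    (h : ∀ k < n, ∀ i j, |timeDeriv (k + 1) x t i - timeDeriv (k + 1) x t j| ≤
      k.factorial * G (k + 1)) (i j : Fin N) (c : ℝ) :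
    |iteratedDerivWithin n (fun τ => Real.sin (x j τ - x i τ + c)) (Ici 0) t| ≤
      n.factorial * G n :=
  abs_iteratedDerivWithin_sin_add_le (φ := fun τ => x j τ - x i τ) (uniqueDiffOn_Ici 0)
    ((hx j).sub (hx i)) ht hG0 hG hmul n
    (fun k hk => by rw [iteratedDerivWithin_phase_sub hx ht]; exact h k hk j i) c

/-- Powers of A are multiplicative, so the sine estimate applies with G(k) = A^k. Two field
derivatives of size κ n! A^n give the factor 2κ ≤ A, supplying the next power. -/
theorem kuramoto_timeDeriv_pair_le (hN : 0 < N) (hκ : 0 ≤ κ) (hA : 2 * κ + vecDiam ν ≤ A)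
    (hy : IsKuramotoSolution κ ν θ₀ y) (n : ℕ) {t : ℝ} (ht : 0 ≤ t) (i j : Fin N) :
    |timeDeriv (n + 1) y t i - timeDeriv (n + 1) y t j| ≤ n.factorial * A ^ (n + 1) := by
  have hν : 0 ≤ vecDiam ν := vecDiam_nonneg _
  have hA0 : 0 ≤ A := by linarith
  induction n using Nat.strong_induction_on generalizing i j with
  | _ n ih =>
    rcases Nat.eq_zero_or_pos n with rfl | hn
    · simpa using (abs_timeDeriv_one_pair_le hN hκ hy i j ht).trans (by linarith)
    · rw [hy.timeDeriv_succ n ht, hy.timeDeriv_succ n ht]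
      have h := abs_iteratedDerivWithin_kuramotoField_le (ν := ν) hN hκ (uniqueDiffOn_Ici 0)
        hy.contDiffOn hn ht (fun i j => abs_sin_phase_le_of_bound (G := fun k => A ^ k)
          hy.contDiffOn ht (by simp) (fun k => by positivity) (fun k l => (pow_add A k l).ge) n
          (fun k hk i j => ih k hk i j) i j 0)
      calc _ ≤ κ * (n.factorial * A ^ n) + κ * (n.factorial * A ^ n) :=
            (abs_sub _ _).trans (add_le_add (h i) (h j))
        _ = n.factorial * A ^ n * (2 * κ) := by ring
        _ ≤ n.factorial * A ^ n * A := by gcongr; linarith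
        _ = _ := by ring

theorem kuramoto_sin_phase_le (hN : 0 < N) (hκ : 0 ≤ κ) (hA : 2 * κ + vecDiam ν ≤ A)
    (hy : IsKuramotoSolution κ ν θ₀ y) (n : ℕ) {t : ℝ} (ht : 0 ≤ t) (i j : Fin N) (c : ℝ) :
    |iteratedDerivWithin n (fun τ => Real.sin (y j τ - y i τ + c)) (Ici 0) t| ≤
      n.factorial * A ^ n := by
  have hν : 0 ≤ vecDiam ν := vecDiam_nonneg _
  have hA0 : 0 ≤ A := by linarith
  exact abs_sin_phase_le_of_bound (G := fun k => A ^ k)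
    hy.contDiffOn ht (by simp) (fun k => by positivity) (fun k l => (pow_add A k l).ge) n
    (fun k _ i j => kuramoto_timeDeriv_pair_le hN hκ hA hy k ht i j) i j c

theorem kuramoto_timeDeriv_le (hN : 0 < N) (hκ : 0 ≤ κ) (hA : 2 * κ + vecDiam ν ≤ A)
    (hy : IsKuramotoSolution κ ν θ₀ y) {n : ℕ} (hn : 0 < n) {t : ℝ} (ht : 0 ≤ t) (i : Fin N) :
    |timeDeriv (n + 1) y t i| ≤ κ * (n.factorial * A ^ n) := by
  rw [hy.timeDeriv_succ n ht]
  exact abs_iteratedDerivWithin_kuramotoField_le hN hκ (uniqueDiffOn_Ici 0) hy.contDiffOn hn ht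
    (fun i j => kuramoto_sin_phase_le hN hκ hA hy n ht i j 0) i

theorem kuramoto_timeDeriv_three_le (hN : 0 < N) (hκ : 0 ≤ κ) (hA : 2 * κ + vecDiam ν ≤ A)
    (hy : IsKuramotoSolution κ ν θ₀ y) {t : ℝ} (ht : 0 ≤ t) (i : Fin N) :
    |timeDeriv 3 y t i| ≤ κ * (3 / 2 * A ^ 2) := by
  have hu := uniqueDiffOn_Ici (0 : ℝ)
  rw [hy.timeDeriv_succ 2 ht]
  refine abs_iteratedDerivWithin_kuramotoField_le hN hκ hu hy.contDiffOn two_pos ht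
    (fun i j => ?_) i
  have hφ : ContDiffOn ℝ ∞ (fun τ => y j τ - y i τ) (Ici 0) :=
    (hy.contDiffOn j).sub (hy.contDiffOn i)
  have h1 := kuramoto_timeDeriv_pair_le hN hκ hA hy 0 ht j i
  have h2 := kuramoto_timeDeriv_pair_le hN hκ hA hy 1 ht j i
  have e2 := iteratedDerivWithin_succ_sin_add hu hφ ht 1 0
  have e1 := iteratedDerivWithin_succ_sin_add hu hφ ht 0 (0 + Real.pi / 2)
  simp only [iteratedDerivWithin_phase_sub hy.contDiffOn ht, Finset.sum_range_succ,
    Finset.sum_range_zero, Nat.choose_zero_right, Nat.cast_one, zero_add, one_mul, tsub_self,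
    iteratedDerivWithin_zero, Nat.choose_self, Nat.factorial_zero, Nat.factorial_one, pow_one,
    tsub_zero, Real.sin_add_pi_div_two, Real.cos_add_pi_div_two, Nat.reduceAdd, ← add_assoc,
    zero_add] at h1 h2 e1 e2
  rw [e2, e1]
  generalize timeDeriv 1 y t j - timeDeriv 1 y t i = a at *
  generalize timeDeriv 2 y t j - timeDeriv 2 y t i = b at *
  generalize y j t - y i t = φ at *
  have ha : |a * a| ≤ A ^ 2 := by
    rw [abs_mul, sq]
    exact mul_self_le_mul_self (abs_nonneg a) h1
  -- The second derivative of the sine is φ'' cos φ - φ'² sin φ, with both coefficients at most A².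
  -- Using sin² + cos² = 1 replaces the generic constant 2 by 3/2.
  have hsc : |Real.sin φ| + |Real.cos φ| ≤ 3 / 2 := by
    have := Real.sin_sq_add_cos_sq φ
    rw [← sq_abs (Real.sin φ), ← sq_abs (Real.cos φ)] at this
    nlinarith [sq_nonneg (|Real.sin φ| - |Real.cos φ|)]
  calc |a * (a * -Real.sin φ) + b * Real.cos φ|
      ≤ |a * a| * |Real.sin φ| + |b| * |Real.cos φ| := by
        rw [← mul_assoc, mul_neg, ← abs_mul, ← abs_mul, ← abs_neg (a * a * Real.sin φ)]
        exact abs_add_le _ _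
    _ ≤ A ^ 2 * |Real.sin φ| + A ^ 2 * |Real.cos φ| := by gcongr
    _ = A ^ 2 * (|Real.sin φ| + |Real.cos φ|) := by ring
    _ ≤ A ^ 2 * (3 / 2) := by gcongr
    _ = _ := by ring

end Bounds

/-! ### Inertial derivatives and the forcing of the difference -/

section HigherDerivatives

variable {N : ℕ} {m κ A P Q : ℝ} {ν θ₀ ω₀ : Fin N → ℝ} {x y : Fin N → ℝ → ℝ}

theorem factorial_succ_real (n : ℕ) : ((n + 1).factorial : ℝ) = (n + 1) * n.factorial := by
  rw [Nat.factorial_succ]; push_cast; ring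

/-- Sharper than the factorial bound for the third derivative. -/
theorem kuramoto_timeDeriv_add_two_le (hN : 0 < N) (hκ : 0 ≤ κ) (hA : 2 * κ + vecDiam ν ≤ A)
    (hy : IsKuramotoSolution κ ν θ₀ y) {n : ℕ} (hn : 0 < n) {t : ℝ} (ht : 0 ≤ t) (i : Fin N) :
    |timeDeriv (n + 2) y t i| ≤
      κ * (n.factorial * (((n : ℝ) ^ 2 + n + 1) / 2) * A ^ (n + 1)) := by
  have hν : 0 ≤ vecDiam ν := vecDiam_nonneg _
  have hA0 : 0 ≤ A := by linarith
  -- The weight (n²+n+1)/2 equals 3/2 at n = 1, where the sharpened bound is needed, and exceeds the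
  -- generic n + 1 from n = 2 on.
  rcases Nat.lt_or_ge n 2 with h | h
  · obtain rfl : n = 1 := by omega
    refine (kuramoto_timeDeriv_three_le hN hκ hA hy ht i).trans (le_of_eq ?_)
    norm_num
  · refine (kuramoto_timeDeriv_le hN hκ hA hy n.succ_pos ht i).trans ?_
    have h2 : (2 : ℝ) ≤ n := by exact_mod_cast h
    rw [Nat.succ_eq_add_one, factorial_succ_real, mul_comm ((n : ℝ) + 1)]
    gcongr
    nlinarith

theorem inertial_sin_phase_le_of_bound (hm : 0 < m) (hA0 : 0 ≤ A) (hAP : A ≤ P)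
    (hx : ∀ i, ContDiffOn ℝ ∞ (x i) (Ici 0)) {t : ℝ} (ht : 0 ≤ t) (n : ℕ)
    (h : ∀ k < n, ∀ i j, |timeDeriv (k + 1) x t i - timeDeriv (k + 1) x t j| ≤
      k.factorial * (layerMajorant P m (k + 1) t + bulkMajorant A m (k + 1) t))
    (i j : Fin N) (c : ℝ) :
    |iteratedDerivWithin n (fun τ => Real.sin (x j τ - x i τ + c)) (Ici 0) t| ≤
      n.factorial * (layerMajorant P m n t + bulkMajorant A m n t) :=
  abs_sin_phase_le_of_bound (G := fun k => layerMajorant P m k t + bulkMajorant A m k t) hx ht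
    layerMajorant_add_bulkMajorant_zero.ge
    (fun k => add_nonneg (layerMajorant_nonneg hm (hA0.trans hAP) ht k)
      (bulkMajorant_nonneg hm hA0 ht k))
    (majorant_mul_majorant_le hm hA0 hAP ht) n h i j c

/-- These inequalities trade each division by m at t = 0 for a power of P. For the last, m P² ≥ (1 +
m A) P = P + A (m P) ≥ P + A. -/
theorem layer_rate_bounds (hm : 0 < m) (hA0 : 0 ≤ A) (hP : A + 1 / m ≤ P) :
    A ≤ P ∧ 0 < P ∧ 1 ≤ m * P ∧ P + A ≤ m * P ^ 2 := by
  have h1 : 0 < 1 / m := by positivity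
  have h2 : 1 ≤ m * P - m * A := by
    have := mul_le_mul_of_nonneg_left hP hm.le
    rw [mul_add, mul_one_div_cancel hm.ne'] at this
    linarith
  have h3 : 0 ≤ m * A := by positivity
  refine ⟨by linarith, by linarith, by linarith, ?_⟩
  nlinarith

theorem inertial_init_pair_le (hN : 0 < N) (hκ : 0 ≤ κ) (hm : 0 < m)
    (hA : 2 * κ + vecDiam ω₀ + vecDiam ν ≤ A) (hP : A + 1 / m ≤ P)
    (hx : IsInertialKuramotoSolution m κ ν θ₀ ω₀ x) (n : ℕ)
    (ih : ∀ k ≤ n, ∀ i j, |timeDeriv (k + 1) x 0 i - timeDeriv (k + 1) x 0 j| ≤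
      k.factorial * P ^ (k + 1)) (i j : Fin N) :
    |timeDeriv (n + 2) x 0 i - timeDeriv (n + 2) x 0 j| ≤ (n + 1).factorial * P ^ (n + 2) := by
  have hν : 0 ≤ vecDiam ν := vecDiam_nonneg _
  have hω : 0 ≤ vecDiam ω₀ := vecDiam_nonneg _
  have hA0 : 0 ≤ A := by linarith
  obtain ⟨hAP, hP0, hmP, hmP2⟩ := layer_rate_bounds hm hA0 hP
  have e1 := hx.relaxation hm n le_rfl i
  have e2 := hx.relaxation hm n le_rfl j
  have hfac : (n.factorial : ℝ) * P ^ (n + 2) ≤ (n + 1).factorial * P ^ (n + 2) := by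
    gcongr
    omega
  refine le_trans (le_of_mul_le_mul_left ?_ hm) hfac
  have key : m * |timeDeriv (n + 2) x 0 i - timeDeriv (n + 2) x 0 j| ≤
      |iteratedDerivWithin n (fun t => kuramotoField κ ν (fun j => x j t) i) (Ici 0) 0 -
        iteratedDerivWithin n (fun t => kuramotoField κ ν (fun j => x j t) j) (Ici 0) 0| +
      |timeDeriv (n + 1) x 0 i - timeDeriv (n + 1) x 0 j| := by
    rw [← abs_of_pos hm, ← abs_mul, ← e1, ← e2]
    refine le_trans (le_of_eq ?_) (abs_sub _ _)
    congr 1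
    ring
  refine key.trans ?_
  rcases Nat.eq_zero_or_pos n with rfl | hn
  · simp only [zero_add, iteratedDerivWithin_zero, hx.init_vel, Nat.factorial_zero, Nat.cast_one,
      one_mul]
    have h1 := abs_kuramotoField_pair_sub_le (ν := ν) hN hκ (fun j => x j 0) i j
    have h2 := abs_sub_le_vecDiam ν i j
    have h3 := abs_sub_le_vecDiam ω₀ i j
    have h4 := abs_add_le ((kuramotoField κ ν (fun j => x j 0) i - ν i) -
      (kuramotoField κ ν (fun j => x j 0) j - ν j)) (ν i - ν j)
    rw [show (kuramotoField κ ν (fun j => x j 0) i - ν i) -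
      (kuramotoField κ ν (fun j => x j 0) j - ν j) + (ν i - ν j) =
      kuramotoField κ ν (fun j => x j 0) i - kuramotoField κ ν (fun j => x j 0) j by ring] at h4
    linarith
  · have h := abs_iteratedDerivWithin_kuramotoField_le (ν := ν) hN hκ (uniqueDiffOn_Ici 0)
      (hx.contDiffOn hm) hn self_mem_Ici (fun i j => inertial_sin_phase_le_of_bound hm hA0 hAP
        (hx.contDiffOn hm) le_rfl n (fun k hk i j => by
          rw [layerMajorant_at_zero, bulkMajorant_at_zero, add_zero]
          exact ih k hk.le i j) i j 0)
    rw [layerMajorant_at_zero, bulkMajorant_at_zero, add_zero] at h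
    calc _ ≤ κ * (n.factorial * P ^ n) + κ * (n.factorial * P ^ n) + n.factorial * P ^ (n + 1) :=
          add_le_add ((abs_sub _ _).trans (add_le_add (h i) (h j))) (ih n le_rfl i j)
      _ = n.factorial * P ^ n * (P + 2 * κ) := by ring
      _ ≤ n.factorial * P ^ n * (m * P ^ 2) := by gcongr; linarith
      _ = _ := by ring

/-- The fields contribute at most 2κ n! (layer n + bulk n), while the majorant supplies n! ((n+1)P ·
layer n + A^{n+1}); 2κ ≤ A ≤ P closes the induction. At order n = 0 the field is bounded directly.
-/
theorem inertial_timeDeriv_pair_le (hN : 0 < N) (hκ : 0 ≤ κ) (hm : 0 < m)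
    (hA : 2 * κ + vecDiam ω₀ + vecDiam ν ≤ A) (hP : A + 1 / m ≤ P)
    (hx : IsInertialKuramotoSolution m κ ν θ₀ ω₀ x) (n : ℕ) {t : ℝ} (ht : 0 ≤ t) (i j : Fin N) :
    |timeDeriv (n + 1) x t i - timeDeriv (n + 1) x t j| ≤
      n.factorial * (layerMajorant P m (n + 1) t + bulkMajorant A m (n + 1) t) := by
  have hν : 0 ≤ vecDiam ν := vecDiam_nonneg _
  have hω : 0 ≤ vecDiam ω₀ := vecDiam_nonneg _
  have hA0 : 0 ≤ A := by linarith
  obtain ⟨hAP, hP0, hmP, hmP2⟩ := layer_rate_bounds hm hA0 hP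
  induction n using Nat.strong_induction_on generalizing t i j with
  | _ n ih =>
    have hinit : |timeDeriv (n + 1) x 0 i - timeDeriv (n + 1) x 0 j| ≤
        n.factorial * P ^ (n + 1) := by
      cases n with
      | zero =>
        simpa [hx.init_vel] using (abs_sub_le_vecDiam ω₀ i j).trans (by linarith)
      | succ n =>
        refine inertial_init_pair_le hN hκ hm hA hP hx n (fun k hk i j => ?_) i j
        simpa [layerMajorant_at_zero, bulkMajorant_at_zero] using ih k (by omega) le_rfl i j
    refine abs_le_of_relaxation hm
      (f := fun t => timeDeriv (n + 1) x t i - timeDeriv (n + 1) x t j)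
      (fun t ht => (hasDerivWithinAt_timeDeriv (hx.contDiffOn hm) (n + 1) i ht).sub
        (hasDerivWithinAt_timeDeriv (hx.contDiffOn hm) (n + 1) j ht))
      (fun t => ((hasDerivAt_layerMajorant (P := P) n t).add
        (hasDerivAt_bulkMajorant (A := A) (n + 1) t)).const_mul (n.factorial : ℝ))
      (by simpa [layerMajorant_at_zero, bulkMajorant_at_zero] using hinit) (fun t ht => ?_) ht
    have e1 := hx.relaxation hm n ht i
    have e2 := hx.relaxation hm n ht j
    rw [show m * (timeDeriv (n + 1 + 1) x t i - timeDeriv (n + 1 + 1) x t j) +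
        (timeDeriv (n + 1) x t i - timeDeriv (n + 1) x t j) =
      iteratedDerivWithin n (fun t => kuramotoField κ ν (fun j => x j t) i) (Ici 0) t -
      iteratedDerivWithin n (fun t => kuramotoField κ ν (fun j => x j t) j) (Ici 0) t by
        rw [← e1, ← e2]; ring]
    have hL := layerMajorant_nonneg (n := n) hm hP0.le ht
    have hrhs : m * (n.factorial * (((n + 1) * P * layerMajorant P m n t -
          layerMajorant P m (n + 1) t) / m + (A ^ (n + 1) - bulkMajorant A m (n + 1) t) / m)) +
        n.factorial * (layerMajorant P m (n + 1) t + bulkMajorant A m (n + 1) t) =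
        n.factorial * ((n + 1) * P * layerMajorant P m n t + A ^ (n + 1)) := by
      field_simp
      ring
    refine le_trans ?_ hrhs.ge
    rcases Nat.eq_zero_or_pos n with rfl | hn
    · have h1 := abs_kuramotoField_pair_sub_le (ν := ν) hN hκ (fun j => x j t) i j
      have h2 := abs_sub_le_vecDiam ν i j
      have h4 := abs_add_le ((kuramotoField κ ν (fun j => x j t) i - ν i) -
        (kuramotoField κ ν (fun j => x j t) j - ν j)) (ν i - ν j)
      rw [show (kuramotoField κ ν (fun j => x j t) i - ν i) -
        (kuramotoField κ ν (fun j => x j t) j - ν j) + (ν i - ν j) =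
        kuramotoField κ ν (fun j => x j t) i - kuramotoField κ ν (fun j => x j t) j by ring] at h4
      have h5 := mul_nonneg hP0.le hL
      simp only [iteratedDerivWithin_zero, Nat.factorial_zero, Nat.cast_one, Nat.cast_zero,
        zero_add, one_mul, pow_one]
      linarith
    · have h := abs_iteratedDerivWithin_kuramotoField_le (ν := ν) hN hκ (uniqueDiffOn_Ici 0)
        (hx.contDiffOn hm) hn ht (fun i j => inertial_sin_phase_le_of_bound hm hA0 hAP
          (hx.contDiffOn hm) ht n (fun k hk i j => ih k hk ht i j) i j 0)
      have hB := bulkMajorant_le (m := m) (t := t) hA0 n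
      have h3 : 2 * κ * layerMajorant P m n t ≤ (n + 1) * P * layerMajorant P m n t := by
        refine mul_le_mul_of_nonneg_right ?_ hL
        nlinarith [(Nat.cast_nonneg n : (0 : ℝ) ≤ n)]
      have h4 : 2 * κ * bulkMajorant A m n t ≤ A ^ (n + 1) := by
        rw [pow_succ, mul_comm (A ^ n)]
        have := bulkMajorant_nonneg hm hA0 ht n
        gcongr
        linarith
      calc _ ≤ _ := (abs_sub _ _).trans (add_le_add (h i) (h j))
        _ = n.factorial * (2 * κ * layerMajorant P m n t + 2 * κ * bulkMajorant A m n t) := by ring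
        _ ≤ _ := by gcongr

/-- The bound for `n`-th derivatives of differences of the sine terms of the two models, given
bounds for the lower order derivatives of the difference of the phases. -/
noncomputable def sineDifferenceMajorant (A P m κ : ℝ) (n : ℕ) (t : ℝ) : ℝ :=
  n.factorial * (2 * n * layerMajorant P m n t +
    m * κ * Real.exp (2 * κ * t) * (n * (n + 7) / 2) *
      (layerMajorant P m n t + bulkMajorant A m n t) +
    m * A * Real.exp (2 * κ * t) * bulkMajorant A m n t)

theorem field_difference_le (hN : 0 < N) (hκ : 0 < κ) (hm : 0 < m)
    (hA : 2 * κ + vecDiam ω₀ + vecDiam ν ≤ A) (hP : A + 1 / m ≤ P)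
    (hx : IsInertialKuramotoSolution m κ ν θ₀ ω₀ x) (hy : IsKuramotoSolution κ ν θ₀ y)
    (n : ℕ) {t : ℝ} (ht : 0 ≤ t)
    (h : ∀ k < n, ∀ i j, |(timeDeriv (k + 1) x t i - timeDeriv (k + 1) y t i) -
        (timeDeriv (k + 1) x t j - timeDeriv (k + 1) y t j)| ≤
      k.factorial * (2 * layerMajorant P m (k + 1) t + m * κ * Real.exp (2 * κ * t) *
        ((k + 1) * (k + 4)) * (layerMajorant P m (k + 1) t + bulkMajorant A m (k + 1) t)))
    (i : Fin N) :
    |iteratedDerivWithin n (fun t => kuramotoField κ ν (fun j => x j t) i) (Ici 0) t -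
      iteratedDerivWithin n (fun t => kuramotoField κ ν (fun j => y j t) i) (Ici 0) t| ≤
    κ * sineDifferenceMajorant A P m κ n t := by
  have hν : 0 ≤ vecDiam ν := vecDiam_nonneg _
  have hω : 0 ≤ vecDiam ω₀ := vecDiam_nonneg _
  have hA0 : 0 ≤ A := by linarith
  obtain ⟨hAP, hP0, -, -⟩ := layer_rate_bounds hm hA0 hP
  refine abs_iteratedDerivWithin_kuramotoField_sub_le hN hκ.le (uniqueDiffOn_Ici 0)
    (hx.contDiffOn hm) hy.contDiffOn ht (fun i j => ?_) i
  refine abs_iteratedDerivWithin_sin_add_sub_le (φ := fun τ => x j τ - x i τ)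
    (ψ := fun τ => y j τ - y i τ)
    (H := fun k => layerMajorant P m k t) (L := fun k => bulkMajorant A m k t)
    (G := fun k => layerMajorant P m k t + bulkMajorant A m k t)
    (uniqueDiffOn_Ici 0) ((hx.contDiffOn hm j).sub (hx.contDiffOn hm i))
    ((hy.contDiffOn j).sub (hy.contDiffOn i)) ht hA0 (by positivity) (by positivity)
    layerMajorant_add_bulkMajorant_zero.ge
    (fun k => add_nonneg (layerMajorant_nonneg hm hP0.le ht k) (bulkMajorant_nonneg hm hA0 ht k))
    (layerMajorant_nonneg hm hP0.le ht) (bulkMajorant_nonneg hm hA0 ht)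
    (majorant_mul_majorant_le hm hA0 hAP ht) (layerMajorant_mul_majorant_le hm hA0 hAP ht)
    (pow_mul_layerMajorant_le hm hA0 hAP ht) (pow_mul_majorant_le hm hA0 hAP ht)
    (fun k l => (pow_mul_bulkMajorant k l).le) n (fun k hk => ?_) (fun k hk => ?_)
    (fun k hk => ?_) ?_ 0
  · rw [iteratedDerivWithin_phase_sub (hx.contDiffOn hm) ht]
    exact inertial_timeDeriv_pair_le hN hκ.le hm hA hP hx k ht j i
  · rw [iteratedDerivWithin_phase_sub hy.contDiffOn ht]
    exact kuramoto_timeDeriv_pair_le hN hκ.le (by linarith) hy k ht j i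
  · rw [iteratedDerivWithin_phase_sub (hx.contDiffOn hm) ht,
      iteratedDerivWithin_phase_sub hy.contDiffOn ht]
    refine le_trans (le_of_eq ?_) (h k hk j i)
    congr 1
    ring
  · have h1 := abs_phase_pair_sub_le hN hκ hm hx hy j i ht
    have h2 := vecDiam_sub_le hN ω₀ ν
    have h3 := exp_neg_div_le_one hm ht
    rw [show x j t - x i t - (y j t - y i t) = x j t - y j t - (x i t - y i t) by ring]
    refine h1.trans ?_
    calc _ ≤ m * A * (1 - Real.exp (-t / m)) * Real.exp (2 * κ * t) := by
          have : 0 ≤ 1 - Real.exp (-t / m) := by linarith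
          gcongr
          linarith
      _ = _ := by simp only [bulkMajorant]; ring

theorem hasDerivAt_exp_mul_layerMajorant (n : ℕ) (κ t : ℝ) :
    HasDerivAt (fun t => Real.exp (2 * κ * t) * layerMajorant P m (n + 1) t)
      (2 * κ * Real.exp (2 * κ * t) * layerMajorant P m (n + 1) t + Real.exp (2 * κ * t) *
        (((n + 1) * P * layerMajorant P m n t - layerMajorant P m (n + 1) t) / m)) t :=
  (hasDerivAt_exp_two_mul κ t).mul (hasDerivAt_layerMajorant n t)

theorem hasDerivAt_exp_mul_bulkMajorant (n : ℕ) (κ t : ℝ) :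
    HasDerivAt (fun t => Real.exp (2 * κ * t) * bulkMajorant A m n t)
      (2 * κ * Real.exp (2 * κ * t) * bulkMajorant A m n t + Real.exp (2 * κ * t) *
        ((A ^ n - bulkMajorant A m n t) / m)) t :=
  (hasDerivAt_exp_two_mul κ t).mul (hasDerivAt_bulkMajorant n t)

/-- Comparison principle with majorants made of an initial layer with rate `Q`, an amplified initial
layer with rate `P`, and an amplified bulk part. -/
theorem abs_le_of_relaxation_majorant (hm : 0 < m) (hκ : 0 ≤ κ) (hA : 0 ≤ A) (hP : 0 ≤ P)
    {f f' : ℝ → ℝ} {a b c : ℝ} {n : ℕ} (hb : 0 ≤ b) (hc : 0 ≤ c)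
    (hf : ∀ t ∈ Ici (0 : ℝ), HasDerivWithinAt f (f' t) (Ici 0) t)
    (h0 : |f 0| ≤ a * Q ^ (n + 1) + b * P ^ (n + 1))
    (h : ∀ t, 0 ≤ t → |m * f' t + f t| ≤ a * ((n + 1) * Q * layerMajorant Q m n t) +
      b * (Real.exp (2 * κ * t) * ((n + 1) * P * layerMajorant P m n t)) +
      c * (Real.exp (2 * κ * t) * A ^ (n + 1))) {t : ℝ} (ht : 0 ≤ t) :
    |f t| ≤ a * layerMajorant Q m (n + 1) t +
      b * (Real.exp (2 * κ * t) * layerMajorant P m (n + 1) t) +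
      c * (Real.exp (2 * κ * t) * bulkMajorant A m (n + 1) t) := by
  refine abs_le_of_relaxation hm hf
    (fun t => (((hasDerivAt_layerMajorant (P := Q) n t).const_mul a).add
      ((hasDerivAt_exp_mul_layerMajorant (P := P) n κ t).const_mul b)).add
      ((hasDerivAt_exp_mul_bulkMajorant (A := A) (n + 1) κ t).const_mul c))
    (by simpa [layerMajorant_at_zero, bulkMajorant_at_zero] using h0) (fun t ht => ?_) ht
  refine (h t ht).trans ?_
  -- Differentiating the amplifying factor e^{2κt} only enlarges the majorant's response, so these
  -- two terms are discarded.
  have h1 : 0 ≤ b * (m * (2 * κ * Real.exp (2 * κ * t) * layerMajorant P m (n + 1) t)) := by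
    have := layerMajorant_nonneg hm hP ht (n + 1)
    positivity
  have h2 : 0 ≤ c * (m * (2 * κ * Real.exp (2 * κ * t) * bulkMajorant A m (n + 1) t)) := by
    have := bulkMajorant_nonneg hm hA ht (n + 1)
    positivity
  have h3 : ∀ u : ℝ, m * (u / m) = u := fun u => by field_simp
  simp only [Pi.add_apply]
  have e1 := h3 ((n + 1) * Q * layerMajorant Q m n t - layerMajorant Q m (n + 1) t)
  have e2 := h3 ((n + 1) * P * layerMajorant P m n t - layerMajorant P m (n + 1) t)
  have e3 := h3 (A ^ (n + 1) - bulkMajorant A m (n + 1) t)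
  linear_combination h1 + h2 - a * e1 - b * Real.exp (2 * κ * t) * e2 -
    c * Real.exp (2 * κ * t) * e3

end HigherDerivatives

/-! ### Differences of higher derivatives -/

section DerivativeDifferences

variable {N : ℕ} {m κ A P Q : ℝ} {ν θ₀ ω₀ : Fin N → ℝ} {x y : Fin N → ℝ → ℝ}

theorem mul_sineDifferenceMajorant_le (hm : 0 < m) (hκ : 0 ≤ κ) (hA : 2 * κ ≤ A) (n : ℕ)
    {t : ℝ} (ht : 0 ≤ t) :
    κ * sineDifferenceMajorant A P m κ n t ≤ n.factorial *
      (2 * κ * n * layerMajorant P m n t +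
        m * κ * Real.exp (2 * κ * t) * (κ * (n * (n + 7) / 2)) * layerMajorant P m n t +
        m * κ * Real.exp (2 * κ * t) * (n * (n + 7) / 4 + 1) * A ^ (n + 1)) := by
  have hA0 : 0 ≤ A := by linarith
  have hL0 := bulkMajorant_nonneg hm hA0 ht n
  have hL := bulkMajorant_le (m := m) (t := t) hA0 n
  have h1 : κ * bulkMajorant A m n t ≤ A / 2 * A ^ n := by
    gcongr
    linarith
  have h2 : A * bulkMajorant A m n t ≤ A * A ^ n := by gcongr
  unfold sineDifferenceMajorant
  generalize bulkMajorant A m n t = L at *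
  generalize layerMajorant P m n t = H at *
  calc _ = n.factorial * (2 * κ * n * H +
        m * κ * Real.exp (2 * κ * t) * (κ * (n * (n + 7) / 2)) * H +
        m * κ * Real.exp (2 * κ * t) * ((n * (n + 7) / 2) * (κ * L) + A * L)) := by ring
    _ ≤ n.factorial * (2 * κ * n * H +
        m * κ * Real.exp (2 * κ * t) * (κ * (n * (n + 7) / 2)) * H +
        m * κ * Real.exp (2 * κ * t) * ((n * (n + 7) / 2) * (A / 2 * A ^ n) + A * A ^ n)) := by
        gcongr
    _ = _ := by ring

theorem relaxation_difference_pair_le (hm : 0 < m)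
    (hx : IsInertialKuramotoSolution m κ ν θ₀ ω₀ x) (hy : IsKuramotoSolution κ ν θ₀ y)
    (n : ℕ) {t M Y : ℝ} (ht : 0 ≤ t)
    (hM : ∀ i, |iteratedDerivWithin n (fun t => kuramotoField κ ν (fun j => x j t) i) (Ici 0) t -
      iteratedDerivWithin n (fun t => kuramotoField κ ν (fun j => y j t) i) (Ici 0) t| ≤ M)
    (hY : ∀ i, |timeDeriv (n + 2) y t i| ≤ Y) (i j : Fin N) :
    |m * ((timeDeriv (n + 2) x t i - timeDeriv (n + 2) y t i) -
        (timeDeriv (n + 2) x t j - timeDeriv (n + 2) y t j)) +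
      ((timeDeriv (n + 1) x t i - timeDeriv (n + 1) y t i) -
        (timeDeriv (n + 1) x t j - timeDeriv (n + 1) y t j))| ≤ 2 * (M + m * Y) := by
  have e1 := relaxation_difference hm hx hy n i ht
  have e2 := relaxation_difference hm hx hy n j ht
  have h1 := abs_le.1 (hM i)
  have h2 := abs_le.1 (hM j)
  have h3 : ∀ i, |m * timeDeriv (n + 2) y t i| ≤ m * Y := fun i => by
    rw [abs_mul, abs_of_pos hm]
    exact mul_le_mul_of_nonneg_left (hY i) hm.le
  have h4 := abs_le.1 (h3 i)
  have h5 := abs_le.1 (h3 j)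
  rw [abs_le]
  constructor <;> linarith

theorem hasDerivWithinAt_difference_pair (hm : 0 < m)
    (hx : IsInertialKuramotoSolution m κ ν θ₀ ω₀ x) (hy : IsKuramotoSolution κ ν θ₀ y)
    (n : ℕ) (i j : Fin N) {t : ℝ} (ht : 0 ≤ t) :
    HasDerivWithinAt (fun t => (timeDeriv n x t i - timeDeriv n y t i) -
        (timeDeriv n x t j - timeDeriv n y t j))
      ((timeDeriv (n + 1) x t i - timeDeriv (n + 1) y t i) -
        (timeDeriv (n + 1) x t j - timeDeriv (n + 1) y t j)) (Ici 0) t :=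
  ((hasDerivWithinAt_timeDeriv (hx.contDiffOn hm) n i ht).sub
      (hasDerivWithinAt_timeDeriv hy.contDiffOn n i ht)).sub
    ((hasDerivWithinAt_timeDeriv (hx.contDiffOn hm) n j ht).sub
      (hasDerivWithinAt_timeDeriv hy.contDiffOn n j ht))

theorem difference_init_pair_le (hN : 0 < N) (hκ : 0 ≤ κ) (hm : 0 < m)
    (hA : 2 * κ + vecDiam ω₀ + vecDiam ν ≤ A) (hP : A + 1 / m ≤ P)
    (hx : IsInertialKuramotoSolution m κ ν θ₀ ω₀ x) (hy : IsKuramotoSolution κ ν θ₀ y)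
    (n : ℕ) (i j : Fin N) :
    |(timeDeriv (n + 1) x 0 i - timeDeriv (n + 1) y 0 i) -
      (timeDeriv (n + 1) x 0 j - timeDeriv (n + 1) y 0 j)| ≤ 2 * n.factorial * P ^ (n + 1) := by
  have hν : 0 ≤ vecDiam ν := vecDiam_nonneg _
  have hω : 0 ≤ vecDiam ω₀ := vecDiam_nonneg _
  have hA0 : 0 ≤ A := by linarith
  obtain ⟨hAP, -, -, -⟩ := layer_rate_bounds hm hA0 hP
  have h1 := inertial_timeDeriv_pair_le hN hκ hm hA hP hx n le_rfl i j
  have h2 := kuramoto_timeDeriv_pair_le (A := A) hN hκ (by linarith) hy n le_rfl i j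
  have h3 : (n.factorial : ℝ) * A ^ (n + 1) ≤ n.factorial * P ^ (n + 1) := by gcongr
  rw [layerMajorant_at_zero, bulkMajorant_at_zero, add_zero] at h1
  rw [show ∀ a b c d : ℝ, a - b - (c - d) = (a - c) - (b - d) by intros; ring]
  exact (abs_sub _ _).trans (by linarith)

/-- Strong induction: lower orders control the difference of fields, and the defect adds a forcing
of size m. The factor 2 on the layer comes from the initial derivatives of the two models, each at
most n! P^{n+1}. -/
theorem difference_timeDeriv_pair_le (hN : 0 < N) (hκ : 0 < κ) (hm : 0 < m)
    (hA : 2 * κ + vecDiam ω₀ + vecDiam ν ≤ A) (hP : A + 1 / m ≤ P)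
    (hx : IsInertialKuramotoSolution m κ ν θ₀ ω₀ x) (hy : IsKuramotoSolution κ ν θ₀ y)
    (n : ℕ) {t : ℝ} (ht : 0 ≤ t) (i j : Fin N) :
    |(timeDeriv (n + 1) x t i - timeDeriv (n + 1) y t i) -
        (timeDeriv (n + 1) x t j - timeDeriv (n + 1) y t j)| ≤
      n.factorial * (2 * layerMajorant P m (n + 1) t + m * κ * Real.exp (2 * κ * t) *
        ((n + 1) * (n + 4)) * (layerMajorant P m (n + 1) t + bulkMajorant A m (n + 1) t)) := by
  have hν : 0 ≤ vecDiam ν := vecDiam_nonneg _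
  have hω : 0 ≤ vecDiam ω₀ := vecDiam_nonneg _
  have hA0 : 0 ≤ A := by linarith
  obtain ⟨hAP, hP0, -, -⟩ := layer_rate_bounds hm hA0 hP
  induction n using Nat.strong_induction_on generalizing t i j with
  | _ n ih =>
    have hn0 : (0 : ℝ) ≤ n := Nat.cast_nonneg n
    have key := abs_le_of_relaxation_majorant (Q := P) (A := A) (n := n)
      (a := 2 * n.factorial) (b := n.factorial * (m * κ * ((n + 1) * (n + 4))))
      (c := n.factorial * (m * κ * ((n + 1) * (n + 4))))
      hm hκ.le hA0 hP0.le (by positivity) (by positivity)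
      (fun t ht => hasDerivWithinAt_difference_pair hm hx hy (n + 1) i j ht)
      ((difference_init_pair_le hN hκ.le hm hA hP hx hy n i j).trans
        (le_add_of_nonneg_right (by positivity)))
      (fun t ht => ?_) ht
    · exact key.trans (le_of_eq (by ring))
    · refine (relaxation_difference_pair_le hm hx hy n ht
        (field_difference_le hN hκ hm hA hP hx hy n ht fun k hk i j => ih k hk ht i j)
        (kuramoto_timeDeriv_le (A := A) hN hκ.le (by linarith) hy n.succ_pos ht) i j).trans ?_
      have h1 := mul_sineDifferenceMajorant_le (A := A) (P := P) hm hκ.le (by linarith) n ht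
      have hE : 1 ≤ Real.exp (2 * κ * t) := Real.one_le_exp (by positivity)
      have hH := layerMajorant_nonneg hm hP0.le ht n
      rw [Nat.succ_eq_add_one, factorial_succ_real]
      generalize sineDifferenceMajorant A P m κ n t = W at *
      generalize layerMajorant P m n t = H at *
      generalize Real.exp (2 * κ * t) = E at *
      have h2 : 2 * κ * n * H ≤ P * (n + 1) * H := by gcongr <;> linarith
      have h3 : m * κ * E * (2 * κ * (n * (n + 7) / 2)) * H ≤
          m * κ * E * (P * ((n + 1) * (n + 1) * (n + 4))) * H := by
        gcongr
        · linarith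
        · nlinarith [mul_nonneg hn0 hn0, mul_nonneg hn0 (mul_nonneg hn0 hn0)]
      have h4 : m * κ * 1 * (n + 1) * A ^ (n + 1) ≤ m * κ * E * (n + 1) * A ^ (n + 1) := by gcongr
      have h5 : m * κ * E * (n * (n + 7) / 2 + 2 + 2 * (n + 1)) * A ^ (n + 1) ≤
          m * κ * E * ((n + 1) * (n + 4)) * A ^ (n + 1) := by
        gcongr
        -- The weight (n+1)(n+4) is tight: equality holds at n = 0 and n = 1, and the inequality
        -- fails for real n strictly between, so integrality is used.
        rcases Nat.eq_zero_or_pos n with rfl | hn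
        · norm_num
        · have : (1 : ℝ) ≤ n := by exact_mod_cast hn
          nlinarith
      calc 2 * (κ * W + m * (κ * ((n + 1) * n.factorial * A ^ (n + 1))))
          ≤ 2 * (n.factorial * (2 * κ * n * H + m * κ * E * (κ * (n * (n + 7) / 2)) * H +
              m * κ * E * (n * (n + 7) / 4 + 1) * A ^ (n + 1)) +
              m * (κ * ((n + 1) * n.factorial * A ^ (n + 1)))) := by gcongr
        _ = n.factorial * (2 * (2 * κ * n * H) + m * κ * E * (2 * κ * (n * (n + 7) / 2)) * H +
              m * κ * E * (n * (n + 7) / 2 + 2) * A ^ (n + 1) +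
              2 * (m * κ * 1 * (n + 1) * A ^ (n + 1))) := by ring
        _ ≤ n.factorial * (2 * (P * (n + 1) * H) +
              m * κ * E * (P * ((n + 1) * (n + 1) * (n + 4))) * H +
              m * κ * E * (n * (n + 7) / 2 + 2) * A ^ (n + 1) +
              2 * (m * κ * E * (n + 1) * A ^ (n + 1))) := by gcongr
        _ = n.factorial * (2 * (P * (n + 1) * H) +
              m * κ * E * (P * ((n + 1) * (n + 1) * (n + 4))) * H +
              m * κ * E * (n * (n + 7) / 2 + 2 + 2 * (n + 1)) * A ^ (n + 1)) := by ring
        _ ≤ n.factorial * (2 * (P * (n + 1) * H) +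
              m * κ * E * (P * ((n + 1) * (n + 1) * (n + 4))) * H +
              m * κ * E * ((n + 1) * (n + 4)) * A ^ (n + 1)) := by gcongr
        _ = _ := by ring

/-- The right-hand side of the relaxation equation for the derivatives of order at least two. -/
theorem relaxation_rhs_le (hN : 0 < N) (hκ : 0 < κ) (hm : 0 < m)
    (hA : 2 * κ + vecDiam ω₀ + vecDiam ν ≤ A) (hP : A + 1 / m ≤ P)
    (hx : IsInertialKuramotoSolution m κ ν θ₀ ω₀ x) (hy : IsKuramotoSolution κ ν θ₀ y)
    {n : ℕ} (hn : 0 < n) {t : ℝ} (ht : 0 ≤ t) :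
    ∃ M Y, (∀ i, |iteratedDerivWithin n (fun t => kuramotoField κ ν (fun j => x j t) i) (Ici 0) t -
      iteratedDerivWithin n (fun t => kuramotoField κ ν (fun j => y j t) i) (Ici 0) t| ≤ M) ∧
      (∀ i, |timeDeriv (n + 2) y t i| ≤ Y) ∧
      M + m * Y ≤ n.factorial * (2 * κ * n * layerMajorant P m n t +
        m * κ * Real.exp (2 * κ * t) * (κ * (n * (n + 7) / 2)) * layerMajorant P m n t) +
        3 / 4 * (m * κ * (n + 2).factorial) * (Real.exp (2 * κ * t) * A ^ (n + 1)) := by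
  have hν : 0 ≤ vecDiam ν := vecDiam_nonneg _
  have hω : 0 ≤ vecDiam ω₀ := vecDiam_nonneg _
  have hA0 : 0 ≤ A := by linarith
  refine ⟨_, _, field_difference_le hN hκ hm hA hP hx hy n ht fun k _ i j =>
    difference_timeDeriv_pair_le hN hκ hm hA hP hx hy k ht i j,
    kuramoto_timeDeriv_add_two_le (A := A) hN hκ.le (by linarith) hy hn ht, ?_⟩
  have h1 := mul_sineDifferenceMajorant_le (A := A) (P := P) hm hκ.le (by linarith) n ht
  have hE : 1 ≤ Real.exp (2 * κ * t) := Real.one_le_exp (by positivity)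
  rw [show (n + 2).factorial = (n + 1 + 1).factorial from rfl, factorial_succ_real (n + 1),
    factorial_succ_real n]
  have h2 : m * (κ * (n.factorial * (((n : ℝ) ^ 2 + n + 1) / 2) * A ^ (n + 1))) * 1 ≤
      m * (κ * (n.factorial * (((n : ℝ) ^ 2 + n + 1) / 2) * A ^ (n + 1))) *
        Real.exp (2 * κ * t) := by gcongr
  push_cast
  -- The bulk weights add up exactly: n(n+7)/4 + 1 + (n²+n+1)/2 = 3/4 (n+1)(n+2).
  linear_combination h1 + h2

theorem difference_timeDeriv_pair_le_of_pos (hN : 0 < N) (hκ : 0 < κ) (hm : 0 < m)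
    (hA : 2 * κ + vecDiam ω₀ + vecDiam ν ≤ A) (hP : A + 1 / m ≤ P)
    (hx : IsInertialKuramotoSolution m κ ν θ₀ ω₀ x) (hy : IsKuramotoSolution κ ν θ₀ y)
    {n : ℕ} (hn : 0 < n) {t : ℝ} (ht : 0 ≤ t) (i j : Fin N) :
    |(timeDeriv (n + 1) x t i - timeDeriv (n + 1) y t i) -
        (timeDeriv (n + 1) x t j - timeDeriv (n + 1) y t j)| ≤
      2 * n.factorial * layerMajorant P m (n + 1) t +
        3 / 2 * (m * κ * (n + 2).factorial) *
          (Real.exp (2 * κ * t) * layerMajorant P m (n + 1) t) +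
        3 / 2 * (m * κ * (n + 2).factorial) *
          (Real.exp (2 * κ * t) * bulkMajorant A m (n + 1) t) := by
  have hν : 0 ≤ vecDiam ν := vecDiam_nonneg _
  have hω : 0 ≤ vecDiam ω₀ := vecDiam_nonneg _
  have hA0 : 0 ≤ A := by linarith
  obtain ⟨hAP, hP0, -, -⟩ := layer_rate_bounds hm hA0 hP
  refine abs_le_of_relaxation_majorant hm hκ.le hA0 hP0.le (by positivity) (by positivity)
    (fun t ht => hasDerivWithinAt_difference_pair hm hx hy (n + 1) i j ht)
    ((difference_init_pair_le hN hκ.le hm hA hP hx hy n i j).trans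
      (le_add_of_nonneg_right (by positivity))) (fun t ht => ?_) ht
  obtain ⟨M, Y, hM, hY, hMY⟩ := relaxation_rhs_le hN hκ hm hA hP hx hy hn ht
  refine (relaxation_difference_pair_le hm hx hy n ht hM hY i j).trans ?_
  have hn0 : (0 : ℝ) ≤ n := Nat.cast_nonneg n
  have hH := layerMajorant_nonneg hm hP0.le ht n
  rw [show (n + 2).factorial = (n + 1 + 1).factorial from rfl, factorial_succ_real (n + 1),
    factorial_succ_real n] at hMY ⊢
  generalize layerMajorant P m n t = H at *
  have h2 : n.factorial * (2 * κ * n * H) ≤ n.factorial * (P * (n + 1) * H) := by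
    gcongr <;> linarith
  have h3 : n.factorial * (m * κ * Real.exp (2 * κ * t) * (2 * κ * (n * (n + 7) / 2)) * H) ≤
      n.factorial * (m * κ * Real.exp (2 * κ * t) *
        (P * (3 / 2 * ((n + 2) * (n + 1) * (n + 1)))) * H) := by
    gcongr
    · linarith
    · nlinarith [mul_nonneg hn0 hn0, mul_nonneg hn0 (mul_nonneg hn0 hn0)]
  push_cast at hMY ⊢
  linear_combination 2 * hMY + 2 * h2 + h3

/-- Diameters do not control individual derivatives, so a second rate Q built from norms is needed.
Each step passes on the Q part without a factorial because m Q ≥ 1; the interaction part gains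
another n!, and 2 n! ≤ (n+1)!. -/
theorem inertial_init_le (hN : 0 < N) (hκ : 0 ≤ κ) (hm : 0 < m)
    (hA : 2 * κ + vecDiam ω₀ + vecDiam ν ≤ A) (hP : A + 1 / m ≤ P)
    (hQ : κ + ‖ω₀‖ + ‖ν‖ ≤ Q) (hmQ : 1 / m ≤ Q)
    (hx : IsInertialKuramotoSolution m κ ν θ₀ ω₀ x) {n : ℕ} (hn : 0 < n) (i : Fin N) :
    |timeDeriv (n + 1) x 0 i| ≤ Q ^ (n + 1) + m * κ * n.factorial * P ^ (n + 1) := by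
  have hν : 0 ≤ vecDiam ν := vecDiam_nonneg _
  have hω : 0 ≤ vecDiam ω₀ := vecDiam_nonneg _
  have hA0 : 0 ≤ A := by linarith
  obtain ⟨hAP, hP0, hmP, -⟩ := layer_rate_bounds hm hA0 hP
  have hmQ' : 1 ≤ m * Q := by
    have := mul_le_mul_of_nonneg_left hmQ hm.le
    rwa [mul_one_div_cancel hm.ne'] at this
  have hQ0 : 0 ≤ Q := le_trans (by positivity) hmQ
  have step : ∀ n, m * |timeDeriv (n + 2) x 0 i| ≤
      |iteratedDerivWithin n (fun t => kuramotoField κ ν (fun j => x j t) i) (Ici 0) 0| +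
      |timeDeriv (n + 1) x 0 i| := by
    intro n
    rw [← hx.relaxation hm n le_rfl i, ← abs_of_pos hm, ← abs_mul, abs_of_pos hm]
    refine le_trans (le_of_eq ?_) (abs_sub _ _)
    congr 1
    ring
  induction n, hn using Nat.le_induction with
  | base =>
    have h1 := step 0
    have h2 := abs_kuramotoField_sub_le (ν := ν) hN hκ (fun j => x j 0) i
    have h3 := abs_apply_le_norm ν i
    have h4 := abs_apply_le_norm ω₀ i
    have h5 := abs_add_le (kuramotoField κ ν (fun j => x j 0) i - ν i) (ν i)
    rw [sub_add_cancel] at h5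
    simp only [zero_add, iteratedDerivWithin_zero, hx.init_vel] at h1
    refine le_trans (le_of_mul_le_mul_left ?_ hm) (le_add_of_nonneg_right (by positivity))
    calc _ ≤ Q := h1.trans (by linarith)
      _ ≤ (m * Q) * Q := le_mul_of_one_le_left hQ0 hmQ'
      _ = _ := by norm_num; ring
  | succ n hn ih =>
    have h1 := step n
    have h2 := abs_iteratedDerivWithin_kuramotoField_le (ν := ν) hN hκ (uniqueDiffOn_Ici 0)
      (hx.contDiffOn hm) hn self_mem_Ici (fun i j => inertial_sin_phase_le_of_bound hm hA0 hAP
        (hx.contDiffOn hm) le_rfl n (fun k hk i j =>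
          inertial_timeDeriv_pair_le hN hκ hm hA hP hx k le_rfl i j) i j 0) i
    rw [layerMajorant_at_zero, bulkMajorant_at_zero, add_zero] at h2
    refine le_of_mul_le_mul_left ((step n).trans ?_) hm
    have h3 : Q ^ (n + 1) ≤ m * Q ^ (n + 2) := by
      calc Q ^ (n + 1) ≤ (m * Q) * Q ^ (n + 1) := le_mul_of_one_le_left (by positivity) hmQ'
        _ = _ := by ring
    have h4 : P ^ (n + 1) ≤ m * P ^ (n + 2) := by
      calc P ^ (n + 1) ≤ (m * P) * P ^ (n + 1) := le_mul_of_one_le_left (by positivity) hmP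
        _ = _ := by ring
    have h5 : P ^ n ≤ m * P ^ (n + 1) := by
      calc P ^ n ≤ (m * P) * P ^ n := le_mul_of_one_le_left (by positivity) hmP
        _ = _ := by ring
    have hn1 : (1 : ℝ) ≤ n := by exact_mod_cast hn
    calc _ ≤ κ * (n.factorial * P ^ n) + (Q ^ (n + 1) + m * κ * n.factorial * P ^ (n + 1)) :=
          add_le_add h2 ih
      _ ≤ κ * (n.factorial * (m * P ^ (n + 1))) +
          (m * Q ^ (n + 2) + m * κ * n.factorial * P ^ (n + 1)) := by gcongr
      _ = m * Q ^ (n + 2) + m * κ * (2 * n.factorial) * P ^ (n + 1) := by ring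
      _ ≤ m * Q ^ (n + 2) + m * κ * ((n + 1) * n.factorial) * (m * P ^ (n + 2)) := by
          gcongr
          linarith
      _ = _ := by rw [factorial_succ_real]; ring

/-- The Q layer pays for initial data only, and its forcing is dropped. All layer forcing from the
fields has rate P and must fit into the amplified P layer. -/
theorem difference_timeDeriv_le_of_pos (hN : 0 < N) (hκ : 0 < κ) (hm : 0 < m)
    (hA : 2 * κ + vecDiam ω₀ + vecDiam ν ≤ A) (hP : A + 9 / (8 * m) ≤ P)
    (hQ : κ + ‖ω₀‖ + ‖ν‖ ≤ Q) (hmQ : 1 / m ≤ Q)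
    (hx : IsInertialKuramotoSolution m κ ν θ₀ ω₀ x) (hy : IsKuramotoSolution κ ν θ₀ y)
    {n : ℕ} (hn : 0 < n) {t : ℝ} (ht : 0 ≤ t) (i : Fin N) :
    |timeDeriv (n + 1) x t i - timeDeriv (n + 1) y t i| ≤
      n.factorial * layerMajorant Q m (n + 1) t +
        9 / 8 * (m * κ * (n + 1).factorial) *
          (Real.exp (2 * κ * t) * layerMajorant P m (n + 1) t) +
        3 / 4 * (m * κ * (n + 2).factorial) *
          (Real.exp (2 * κ * t) * bulkMajorant A m (n + 1) t) := by
  have hν : 0 ≤ vecDiam ν := vecDiam_nonneg _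
  have hω : 0 ≤ vecDiam ω₀ := vecDiam_nonneg _
  have hA0 : 0 ≤ A := by linarith
  have hP1 : A + 1 / m ≤ P := by
    refine le_trans ?_ hP
    have : 9 / (8 * m) = 9 / 8 * (1 / m) := by field_simp
    rw [this]
    have : 0 < 1 / m := by positivity
    linarith
  have hP2 : 9 / 8 ≤ m * P := by
    have := mul_le_mul_of_nonneg_left hP hm.le
    rw [mul_add, show m * (9 / (8 * m)) = 9 / 8 by field_simp] at this
    have h : 0 ≤ m * A := by positivity
    linarith
  obtain ⟨hAP, hP0, hmP, -⟩ := layer_rate_bounds hm hA0 hP1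
  have hQ0 : 0 ≤ Q := le_trans (by positivity) hmQ
  have hn1 : (1 : ℝ) ≤ n := by exact_mod_cast hn
  refine abs_le_of_relaxation_majorant hm hκ.le hA0 hP0.le (by positivity) (by positivity)
    (f := fun t => timeDeriv (n + 1) x t i - timeDeriv (n + 1) y t i)
    (fun t ht => (hasDerivWithinAt_timeDeriv (hx.contDiffOn hm) (n + 1) i ht).sub
      (hasDerivWithinAt_timeDeriv hy.contDiffOn (n + 1) i ht)) ?_ (fun t ht => ?_) ht
  · have h1 := inertial_init_le hN hκ.le hm hA hP1 hQ hmQ hx hn i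
    have h2 := kuramoto_timeDeriv_le (A := A) hN hκ.le (by linarith) hy hn le_rfl i
    have hfac : (1 : ℝ) ≤ n.factorial := by exact_mod_cast n.factorial_pos
    calc _ ≤ (Q ^ (n + 1) + m * κ * n.factorial * P ^ (n + 1)) + κ * (n.factorial * A ^ n) :=
          (abs_sub _ _).trans (add_le_add h1 h2)
      _ ≤ (Q ^ (n + 1) + m * κ * n.factorial * P ^ (n + 1)) +
          κ * (n.factorial * ((m * P) * P ^ n)) := by
          gcongr
          exact (pow_le_pow_left₀ hA0 hAP n).trans (le_mul_of_one_le_left (by positivity) hmP)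
      _ = 1 * Q ^ (n + 1) + 1 * (m * κ * (2 * n.factorial)) * P ^ (n + 1) := by ring
      _ ≤ n.factorial * Q ^ (n + 1) +
          9 / 8 * (m * κ * ((n + 1) * n.factorial)) * P ^ (n + 1) := by
          gcongr
          · norm_num
          · linarith
      _ = _ := by rw [factorial_succ_real]
  · obtain ⟨M, Y, hM, hY, hMY⟩ := relaxation_rhs_le hN hκ hm hA hP1 hx hy hn ht
    rw [relaxation_difference hm hx hy n i ht]
    have h1 : |m * timeDeriv (n + 2) y t i| ≤ m * Y := by
      rw [abs_mul, abs_of_pos hm]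
      exact mul_le_mul_of_nonneg_left (hY i) hm.le
    refine ((abs_sub _ _).trans (add_le_add (hM i) h1)).trans (hMY.trans ?_)
    have hH := layerMajorant_nonneg hm hP0.le ht n
    have hHQ := layerMajorant_nonneg hm hQ0 ht n
    have hE : 1 ≤ Real.exp (2 * κ * t) := Real.one_le_exp (by positivity)
    have h2 : 0 ≤ n.factorial * ((n + 1) * Q * layerMajorant Q m n t) := by positivity
    rw [factorial_succ_real n]
    generalize layerMajorant P m n t = H at *
    generalize Real.exp (2 * κ * t) = E at *
    have h3 : n.factorial * (2 * κ * n * H) ≤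
        n.factorial * (16 / 9 * (m * κ * E * P) * n * H) := by
      -- Here 9/8 ≤ m P buys the missing factor m: a layer term without m is moved into the one
      -- carrying m κ e^{2κt}.
      have : 2 * κ ≤ 16 / 9 * (m * κ * E * P) := by
        calc 2 * κ = 16 / 9 * κ * 1 * (9 / 8) := by ring
          _ ≤ 16 / 9 * κ * E * (m * P) := by gcongr
          _ = _ := by ring
      gcongr
    have h4 : n.factorial * (m * κ * E * (2 * κ * (n * (n + 7) / 4)) * H) ≤
        n.factorial * (m * κ * E * (P * (n * (n + 7) / 4)) * H) := by
      gcongr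
      linarith
    have h5 : n.factorial * (m * κ * E * P * (16 / 9 * n + n * (n + 7) / 4) * H) ≤
        n.factorial * (m * κ * E * P * (9 / 8 * ((n + 1) * (n + 1))) * H) := by
      gcongr
      nlinarith
    linear_combination h2 + h3 + h4 + h5

end DerivativeDifferences

/-! ### Final bounds -/

section Conclusions

variable {N : ℕ} {m κ : ℝ} {ν θ₀ ω₀ : Fin N → ℝ} {x y : Fin N → ℝ → ℝ}

theorem add_one_div_le (hm : 0 < m) (A : ℝ) : A + 1 / m ≤ A + 9 / (8 * m) := by
  have h1 : 9 / (8 * m) = 9 / 8 * (1 / m) := by field_simp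
  have h2 : 0 < 1 / m := by positivity
  rw [h1]
  linarith

theorem norm_difference_timeDeriv_le (hN : 0 < N) (hκ : 0 < κ) (hm : 0 < m)
    (hx : IsInertialKuramotoSolution m κ ν θ₀ ω₀ x) (hy : IsKuramotoSolution κ ν θ₀ y)
    {n : ℕ} (hn : 2 ≤ n) {t : ℝ} (ht : 0 ≤ t) :
    ‖timeDeriv n x t - timeDeriv n y t‖ ≤
      (Nat.factorial (n - 1) : ℝ) * (2 * κ + ‖ω₀‖ + ‖ν‖ + 9 / (8 * m)) ^ n
          * (1 + t / m) ^ n * Real.exp (-t / m)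
        + 9 / 8 * m * κ * (Nat.factorial n : ℝ) * Real.exp (2 * κ * t)
          * (2 * κ + vecDiam ω₀ + vecDiam ν + 9 / (8 * m)) ^ n
          * (1 + t / m) ^ n * Real.exp (-t / m)
        + 3 / 4 * m * κ * (Nat.factorial (n + 1) : ℝ) * Real.exp (2 * κ * t)
          * (2 * κ + vecDiam ω₀ + vecDiam ν) ^ n * (1 - Real.exp (-t / m)) := by
  obtain ⟨n, rfl⟩ : ∃ k, n = k + 1 := ⟨n - 1, by omega⟩
  have h9 := add_one_div_le hm 0
  simp only [zero_add] at h9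
  have key := difference_timeDeriv_le_of_pos hN hκ hm le_rfl le_rfl
    (Q := 2 * κ + ‖ω₀‖ + ‖ν‖ + 9 / (8 * m))
    (by have : 0 < 9 / (8 * m) := by positivity
        linarith)
    (h9.trans (le_add_of_nonneg_left (by positivity))) hx hy (n := n) (by omega) ht
  have : Nonempty (Fin N) := ⟨⟨0, hN⟩⟩
  refine (pi_norm_le_iff_of_nonempty _).2 fun i => (key i).trans (le_of_eq ?_)
  simp only [layerMajorant, bulkMajorant, mul_pow, Nat.add_sub_cancel]
  ring

theorem vecDiam_difference_timeDeriv_le (hN : 0 < N) (hκ : 0 < κ) (hm : 0 < m)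
    (hx : IsInertialKuramotoSolution m κ ν θ₀ ω₀ x) (hy : IsKuramotoSolution κ ν θ₀ y)
    {n : ℕ} (hn : 2 ≤ n) {t : ℝ} (ht : 0 ≤ t) :
    vecDiam (timeDeriv n x t - timeDeriv n y t) ≤
      2 * (Nat.factorial (n - 1) : ℝ) * (2 * κ + vecDiam ω₀ + vecDiam ν + 9 / (8 * m)) ^ n
          * (1 + t / m) ^ n * Real.exp (-t / m)
        + 3 / 2 * (Nat.factorial (n + 1) : ℝ) * m * κ * Real.exp (2 * κ * t)
          * (2 * κ + vecDiam ω₀ + vecDiam ν + 9 / (8 * m)) ^ n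
          * (1 + t / m) ^ n * Real.exp (-t / m)
        + 3 / 2 * (Nat.factorial (n + 1) : ℝ) * m * κ * Real.exp (2 * κ * t)
          * (2 * κ + vecDiam ω₀ + vecDiam ν) ^ n * (1 - Real.exp (-t / m)) := by
  obtain ⟨n, rfl⟩ : ∃ k, n = k + 1 := ⟨n - 1, by omega⟩
  have key := difference_timeDeriv_pair_le_of_pos hN hκ hm le_rfl (add_one_div_le hm _) hx hy
    (n := n) (by omega) ht
  refine vecDiam_le hN fun i j => (key i j).trans (le_of_eq ?_)
  simp only [layerMajorant, bulkMajorant, mul_pow, Nat.add_sub_cancel]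
  ring

theorem norm_velocity_sub_lt (hN : 0 < N) (hκ : 0 < κ) (hm : 0 < m)
    (hx : IsInertialKuramotoSolution m κ ν θ₀ ω₀ x) (hy : IsKuramotoSolution κ ν θ₀ y)
    {t : ℝ} (ht : 0 ≤ t) :
    ‖timeDeriv 1 x t - timeDeriv 1 y t‖ <
      (‖ω₀ - ν‖ + κ) * Real.exp (-t / m) + m * κ * (vecDiam ν + 2 * κ)
        + m * κ * (vecDiam (ω₀ - ν) + 2 * κ) * Real.exp (2 * κ * t) := by
  have h1 : 0 ≤ vecDiam (ω₀ - ν) := vecDiam_nonneg _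
  have h2 : 0 ≤ vecDiam ν := vecDiam_nonneg _
  exact (pi_norm_lt_iff (by positivity)).2 fun i => abs_velocity_sub_lt hN hκ hm hx hy i ht

/-- A diameter is at most twice the norm, so every base in the detailed bounds is at most 2B, where
B is the base in the statement. Order 1 is deduced separately from the velocity estimate, the
detailed bounds starting at order 2. -/
theorem difference_timeDeriv_le_uniform (hN : 0 < N) (hκ : 0 < κ) (hm : 0 < m)
    (hx : IsInertialKuramotoSolution m κ ν θ₀ ω₀ x) (hy : IsKuramotoSolution κ ν θ₀ y)
    {n : ℕ} (hn : 1 ≤ n) {t : ℝ} (ht : 0 ≤ t) (i : Fin N) :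
    |timeDeriv n x t i - timeDeriv n y t i| ≤
      (Nat.factorial (n + 1) : ℝ) * 2 ^ n *
        (κ + (⨆ j, |ω₀ j|) + (⨆ j, |ν j|) + 1 / m) ^ n *
        ((1 + t / m) ^ n * Real.exp (-t / m) * (1 + m * κ * Real.exp (2 * κ * t))
          + m * κ * Real.exp (2 * κ * t)) := by
  rw [iSup_abs_eq_norm _ hN, iSup_abs_eq_norm _ hN]
  have hω := vecDiam_le_two_mul_norm hN ω₀
  have hν := vecDiam_le_two_mul_norm hN ν
  have hων := vecDiam_sub_le hN ω₀ ν
  have hω0 : 0 ≤ vecDiam ω₀ := vecDiam_nonneg _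
  have hν0 : 0 ≤ vecDiam ν := vecDiam_nonneg _
  have hnω := norm_nonneg ω₀
  have hnν := norm_nonneg ν
  have hm1 : 0 < 1 / m := by positivity
  have h98 : 9 / (8 * m) = 9 / 8 * (1 / m) := by field_simp
  have hE : 1 ≤ Real.exp (2 * κ * t) := Real.one_le_exp (by positivity)
  rcases Nat.lt_or_ge n 2 with h | h
  · obtain rfl : n = 1 := by omega
    have h1 := (abs_velocity_sub_lt hN hκ hm hx hy i ht).le
    have h2 := norm_sub_le ω₀ ν
    have htm : 0 ≤ t / m := by positivity
    generalize Real.exp (2 * κ * t) = E at *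
    have he := Real.exp_pos (-t / m)
    generalize Real.exp (-t / m) = e at *
    set B := κ + ‖ω₀‖ + ‖ν‖ + 1 / m with hB
    have hB0 : 0 ≤ B := by positivity
    have a1 : ‖ω₀ - ν‖ + κ ≤ B := by linarith
    have a2 : (vecDiam ν + 2 * κ) + (vecDiam (ω₀ - ν) + 2 * κ) ≤ 4 * B := by linarith
    have a3 : 0 ≤ (t / m) * e * B := by positivity
    have a4 : 0 ≤ B * ((1 + t / m) * e * (m * κ * E)) := by positivity
    have a5 : 0 ≤ B * e := by positivity
    calc _ ≤ _ := h1
      _ ≤ B * e + m * κ * (vecDiam ν + 2 * κ) * E + m * κ * (vecDiam (ω₀ - ν) + 2 * κ) * E := by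
          gcongr ?_ + ?_ + _
          · gcongr
          · exact le_mul_of_one_le_right (by positivity) hE
      _ = B * e + m * κ * E * ((vecDiam ν + 2 * κ) + (vecDiam (ω₀ - ν) + 2 * κ)) := by ring
      _ ≤ B * e + m * κ * E * (4 * B) := by gcongr
      _ ≤ _ := by
          norm_num
          linarith
  · have h1 := (abs_apply_le_norm _ i).trans (norm_difference_timeDeriv_le hN hκ hm hx hy h ht)
    set B := κ + ‖ω₀‖ + ‖ν‖ + 1 / m with hB
    have hB0 : 0 ≤ B := by positivity
    have he := Real.exp_pos (-t / m)
    have he1 := exp_neg_div_le_one hm ht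
    have f1 : ((n - 1).factorial : ℝ) ≤ (n + 1).factorial := by
      exact_mod_cast Nat.factorial_le (by omega)
    have f2 : 9 / 8 * (n.factorial : ℝ) ≤ (n + 1).factorial := by
      rw [factorial_succ_real]
      have : (2 : ℝ) ≤ n := by exact_mod_cast h
      gcongr
      linarith
    have b1 : 2 * κ + ‖ω₀‖ + ‖ν‖ + 9 / (8 * m) ≤ 2 * B := by rw [h98]; linarith
    have b2 : 2 * κ + vecDiam ω₀ + vecDiam ν + 9 / (8 * m) ≤ 2 * B := by rw [h98]; linarith
    have b3 : 2 * κ + vecDiam ω₀ + vecDiam ν ≤ 2 * B := by linarith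
    generalize Real.exp (2 * κ * t) = E at *
    generalize Real.exp (-t / m) = e at *
    calc _ ≤ _ := h1
      _ = ((n - 1).factorial : ℝ) * (2 * κ + ‖ω₀‖ + ‖ν‖ + 9 / (8 * m)) ^ n
            * (1 + t / m) ^ n * e
          + m * κ * (9 / 8 * (n.factorial : ℝ)) * E
            * (2 * κ + vecDiam ω₀ + vecDiam ν + 9 / (8 * m)) ^ n * (1 + t / m) ^ n * e
          + m * κ * (3 / 4 * ((n + 1).factorial : ℝ)) * E
            * (2 * κ + vecDiam ω₀ + vecDiam ν) ^ n * (1 - e) := by ring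
      _ ≤ ((n + 1).factorial : ℝ) * (2 * B) ^ n * (1 + t / m) ^ n * e
          + m * κ * ((n + 1).factorial : ℝ) * E * (2 * B) ^ n * (1 + t / m) ^ n * e
          + m * κ * (1 * ((n + 1).factorial : ℝ)) * E * (2 * B) ^ n * 1 := by
          have : 0 ≤ 1 - e := by linarith
          gcongr
          · norm_num
          · linarith
      _ = _ := by rw [mul_pow]; ring

end Conclusions

/-! ### Convergence as m → 0+ -/

section Convergence

theorem tendstoUniformlyOn_of_abs_sub_le {F : ℝ → ℝ → ℝ} {f b : ℝ → ℝ} {S : Set ℝ}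
    (hb : Tendsto b (𝓝[>] 0) (𝓝 0)) (h : ∀ m, 0 < m → ∀ t ∈ S, |F m t - f t| ≤ b m) :
    TendstoUniformlyOn F f (𝓝[>] 0) S := by
  rw [Metric.tendstoUniformlyOn_iff]
  intro ε hε
  filter_upwards [hb.eventually (gt_mem_nhds hε), self_mem_nhdsWithin] with m hm1 hm2 t ht
  rw [dist_comm, Real.dist_eq]
  exact (h m hm2 t ht).trans_lt hm1

/-- In the variable u = T/m, which tends to infinity, the expression is a polynomial in u divided by
e^u. -/
theorem tendsto_poly_mul_exp_neg_div {T : ℝ} (hT : 0 < T) (K S : ℝ) (n : ℕ) :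
    Tendsto (fun m : ℝ => (K + 9 / (8 * m)) ^ n * (1 + S / m) ^ n * Real.exp (-T / m))
      (𝓝[>] 0) (𝓝 0) := by
  have h1 : Tendsto (fun m : ℝ => T / m) (𝓝[>] 0) atTop := by
    simpa [div_eq_mul_inv] using tendsto_inv_nhdsGT_zero.const_mul_atTop hT
  have h2 := (Polynomial.tendsto_div_exp_atTop
    ((Polynomial.C K + Polynomial.C (9 / (8 * T)) * Polynomial.X) ^ n *
      (1 + Polynomial.C (S / T) * Polynomial.X) ^ n)).comp h1
  refine h2.congr' ?_
  filter_upwards [self_mem_nhdsWithin] with m hm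
  have hm' : m ≠ 0 := ne_of_gt hm
  simp only [Function.comp_apply, Polynomial.eval_mul, Polynomial.eval_pow, Polynomial.eval_add,
    Polynomial.eval_C, Polynomial.eval_X, Polynomial.eval_one]
  rw [neg_div, Real.exp_neg, ← div_eq_mul_inv]
  congr 4
  · field_simp
  · field_simp

theorem tendsto_id_mul_const_nhdsGT (c : ℝ) :
    Tendsto (fun m : ℝ => m * c) (𝓝[>] 0) (𝓝 0) := by
  have : Tendsto (fun m : ℝ => m * c) (𝓝 0) (𝓝 (0 * c)) := tendsto_id.mul_const c
  rw [zero_mul] at this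
  exact this.mono_left nhdsWithin_le_nhds

theorem iteratedDerivWithin_Ioi_eq_Ici (f : ℝ → ℝ) (n : ℕ) {t : ℝ} (ht : 0 < t) :
    iteratedDerivWithin n f (Ioi 0) t = iteratedDerivWithin n f (Ici 0) t := by
  have : Ioi (0 : ℝ) =ᶠ[𝓝 t] Ici 0 := by
    filter_upwards [Ioi_mem_nhds ht] with s hs
    exact propext ⟨fun h => le_of_lt h, fun _ => hs⟩
  rw [iteratedDerivWithin, iteratedDerivWithin, iteratedFDerivWithin_congr_set this]

variable {N : ℕ} {κ : ℝ} {ν θ₀ ω₀ : Fin N → ℝ} {θ : ℝ → Fin N → ℝ → ℝ}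

theorem tendstoC0_phase (hN : 0 < N) (hκ : 0 < κ)
    (hθ : ∀ m : ℝ, 0 < m → IsInertialKuramotoSolution m κ ν θ₀ ω₀ (θ m))
    (hθ0 : IsKuramotoSolution κ ν θ₀ (θ 0)) (i : Fin N) :
    TendstoC0 (fun m => θ m i) (θ 0 i) := by
  refine ⟨fun m hm => ((hθ m hm).regular i).continuousOn, (hθ0.regular i).continuousOn,
    fun T _ => tendstoUniformlyOn_of_abs_sub_le (tendsto_id_mul_const_nhdsGT
      ((2 * (⨆ j, |ω₀ j - ν j|) + κ) * Real.exp (2 * κ * T))) fun m hm t ht => ?_⟩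
  have h1 := abs_phase_sub_le hN hκ hm (hθ m hm) hθ0 i ht.1
  have h2 : 0 ≤ ⨆ j, |ω₀ j - ν j| := Real.iSup_nonneg fun _ => abs_nonneg _
  rw [mul_assoc] at h1
  refine h1.trans ?_
  gcongr
  exact ht.2

theorem tendstoUniformlyOn_timeDeriv (hN : 0 < N) (hκ : 0 < κ)
    (hθ : ∀ m : ℝ, 0 < m → IsInertialKuramotoSolution m κ ν θ₀ ω₀ (θ m))
    (hθ0 : IsKuramotoSolution κ ν θ₀ (θ 0)) (i : Fin N) (n : ℕ) {T₁ T₂ : ℝ} (hT : 0 < T₁) :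
    TendstoUniformlyOn (fun m t => timeDeriv n (θ m) t i) (fun t => timeDeriv n (θ 0) t i)
      (𝓝[>] 0) (Icc T₁ T₂) := by
  have hω0 : 0 ≤ vecDiam ω₀ := vecDiam_nonneg _
  have hν0 : 0 ≤ vecDiam ν := vecDiam_nonneg _
  have hων : 0 ≤ vecDiam (ω₀ - ν) := vecDiam_nonneg _
  have hexp : ∀ m t : ℝ, 0 < m → t ∈ Icc T₁ T₂ → Real.exp (-t / m) ≤ Real.exp (-T₁ / m) := by
    intro m t hm ht
    gcongr
    exact ht.1
  rcases Nat.lt_or_ge n 2 with h | h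
  · interval_cases n
    · simp only [timeDeriv_zero]
      rcases lt_or_ge T₂ T₁ with h12 | h12
      · rw [Icc_eq_empty (not_le.2 h12)]
        exact tendstoUniformlyOn_empty
      · exact ((tendstoC0_phase hN hκ hθ hθ0 i).2.2 T₂ (hT.trans_le h12)).mono
          (Icc_subset_Icc_left hT.le)
    -- With exponent 0 both polynomial factors are 1, leaving the bare decay of e^{-T₁/m}.
    · have hb := ((tendsto_poly_mul_exp_neg_div hT 0 0 0).const_mul (‖ω₀ - ν‖ + κ)).add
        (tendsto_id_mul_const_nhdsGT (κ * (vecDiam ν + 2 * κ) +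
          κ * (vecDiam (ω₀ - ν) + 2 * κ) * Real.exp (2 * κ * T₂)))
      rw [mul_zero, add_zero] at hb
      refine tendstoUniformlyOn_of_abs_sub_le hb fun m hm t ht => ?_
      refine (abs_velocity_sub_lt hN hκ hm (hθ m hm) hθ0 i (hT.le.trans ht.1)).le.trans ?_
      calc _ ≤ (‖ω₀ - ν‖ + κ) * Real.exp (-T₁ / m) + m * κ * (vecDiam ν + 2 * κ)
            + m * κ * (vecDiam (ω₀ - ν) + 2 * κ) * Real.exp (2 * κ * T₂) := by
            gcongr
            · exact ht.1
            · exact ht.2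
        _ = _ := by ring
  · have hb := ((((tendsto_poly_mul_exp_neg_div hT (2 * κ + ‖ω₀‖ + ‖ν‖) T₂ n).const_mul
        ((n - 1).factorial : ℝ))).add
        ((tendsto_id_mul_const_nhdsGT (9 / 8 * κ * n.factorial * Real.exp (2 * κ * T₂))).mul
          (tendsto_poly_mul_exp_neg_div hT (2 * κ + vecDiam ω₀ + vecDiam ν) T₂ n))).add
        (tendsto_id_mul_const_nhdsGT (3 / 4 * κ * (n + 1).factorial * Real.exp (2 * κ * T₂) *
          (2 * κ + vecDiam ω₀ + vecDiam ν) ^ n))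
    simp only [mul_zero, add_zero] at hb
    refine tendstoUniformlyOn_of_abs_sub_le hb fun m hm t ht => ?_
    have ht0 : 0 ≤ t := hT.le.trans ht.1
    have ht2 := ht.2
    refine ((abs_apply_le_norm _ i).trans
      (norm_difference_timeDeriv_le hN hκ hm (hθ m hm) hθ0 h ht0)).trans ?_
    have he := hexp m t hm ht
    have he0 := Real.exp_pos (-t / m)
    have he1 : 0 ≤ 1 - Real.exp (-t / m) := by linarith [exp_neg_div_le_one hm ht0]
    have hT2 : 0 ≤ T₂ := ht0.trans ht2
    generalize Real.exp (-t / m) = e at *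
    generalize Real.exp (-T₁ / m) = e' at *
    calc _ ≤ (Nat.factorial (n - 1) : ℝ) * (2 * κ + ‖ω₀‖ + ‖ν‖ + 9 / (8 * m)) ^ n
            * (1 + T₂ / m) ^ n * e'
          + 9 / 8 * m * κ * (Nat.factorial n : ℝ) * Real.exp (2 * κ * T₂)
            * (2 * κ + vecDiam ω₀ + vecDiam ν + 9 / (8 * m)) ^ n
            * (1 + T₂ / m) ^ n * e'
          + 3 / 4 * m * κ * (Nat.factorial (n + 1) : ℝ) * Real.exp (2 * κ * T₂)
            * (2 * κ + vecDiam ω₀ + vecDiam ν) ^ n * 1 := by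
          gcongr
          linarith
      _ = _ := by ring

theorem tendstoCInfty_phase (hN : 0 < N) (hκ : 0 < κ)
    (hθ : ∀ m : ℝ, 0 < m → IsInertialKuramotoSolution m κ ν θ₀ ω₀ (θ m))
    (hθ0 : IsKuramotoSolution κ ν θ₀ (θ 0)) (i : Fin N) :
    TendstoCInfty (fun m => θ m i) (θ 0 i) := by
  refine ⟨fun m hm => ((hθ m hm).contDiffOn hm i).mono Ioi_subset_Ici_self,
    (hθ0.contDiffOn i).mono Ioi_subset_Ici_self, fun n T₁ T₂ hT _ => ?_⟩
  refine ((tendstoUniformlyOn_timeDeriv hN hκ hθ hθ0 i n hT).congr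
    (Eventually.of_forall fun m t ht => ?_)).congr_right fun t ht => ?_
  · exact (iteratedDerivWithin_Ioi_eq_Ici _ n (hT.trans_le ht.1)).symm
  · exact (iteratedDerivWithin_Ioi_eq_Ici _ n (hT.trans_le ht.1)).symm

end Convergence

end

/-- `θ m i t` is the `i`-th phase at time `t`, for inertia `m > 0`, and for the first-order
model when `m = 0`. The norm `‖·‖` on `Fin N → ℝ` is the maximum norm. -/
theorem theorem1p2 (N : ℕ) (hN : 0 < N) (κ : ℝ) (hκ : 0 < κ)
    (ν θ₀ ω₀ : Fin N → ℝ) (θ : ℝ → Fin N → ℝ → ℝ)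
    (hθ : ∀ m : ℝ, 0 < m → IsInertialKuramotoSolution m κ ν θ₀ ω₀ (θ m))
    (hθ0 : IsKuramotoSolution κ ν θ₀ (θ 0)) :
    -- the solutions are smooth up to `t = 0`
    (∀ m : ℝ, 0 ≤ m → ∀ i, ContDiffOn ℝ ∞ (θ m i) (Set.Ici 0)) ∧
    -- convergence of the phases
    (∀ i, TendstoC0 (fun m => θ m i) (θ 0 i)) ∧
    (∀ m t : ℝ, 0 < m → 0 ≤ t →
      (∀ i, |θ m i t - θ 0 i t| ≤ m * (2 * (⨆ j, |ω₀ j - ν j|) + κ) * Real.exp (2 * κ * t)) ∧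
      ‖(fun i => θ m i t - θ 0 i t)‖ <
        m * |((⨆ i, (ω₀ i - ν i)) + (⨅ i, (ω₀ i - ν i))) / 2|
          + 1 / 2 * m * (vecDiam (ω₀ - ν) + 2 * κ) * Real.exp (2 * κ * t) ∧
      vecDiam (fun i => θ m i t - θ 0 i t) <
        m * (vecDiam (ω₀ - ν) + 2 * κ) * Real.exp (2 * κ * t)) ∧
    -- convergence of all derivatives
    (∀ i, TendstoCInfty (fun m => θ m i) (θ 0 i)) ∧
    (∀ (n : ℕ) (m t : ℝ), 1 ≤ n → 0 < m → 0 ≤ t → ∀ i,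
      |timeDeriv n (θ m) t i - timeDeriv n (θ 0) t i| ≤
        (Nat.factorial (n + 1) : ℝ) * 2 ^ n *
          (κ + (⨆ j, |ω₀ j|) + (⨆ j, |ν j|) + 1 / m) ^ n *
          ((1 + t / m) ^ n * Real.exp (-t / m) * (1 + m * κ * Real.exp (2 * κ * t))
            + m * κ * Real.exp (2 * κ * t))) ∧
    -- detailed bounds for the first derivative
    (∀ m t : ℝ, 0 < m → 0 ≤ t →
      ‖timeDeriv 1 (θ m) t - timeDeriv 1 (θ 0) t‖ <
        (‖ω₀ - ν‖ + κ) * Real.exp (-t / m) + m * κ * (vecDiam ν + 2 * κ)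
          + m * κ * (vecDiam (ω₀ - ν) + 2 * κ) * Real.exp (2 * κ * t) ∧
      vecDiam (timeDeriv 1 (θ m) t - timeDeriv 1 (θ 0) t) <
        (vecDiam (ω₀ - ν) + 2 * κ) * Real.exp (-t / m) + 2 * m * κ * (vecDiam ν + 2 * κ)
          + 2 * m * κ * (vecDiam (ω₀ - ν) + 2 * κ) * Real.exp (2 * κ * t)) ∧
    -- detailed bounds for the higher derivatives
    (∀ (n : ℕ) (m t : ℝ), 2 ≤ n → 0 < m → 0 ≤ t →
      ‖timeDeriv n (θ m) t - timeDeriv n (θ 0) t‖ ≤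
        (Nat.factorial (n - 1) : ℝ) * (2 * κ + ‖ω₀‖ + ‖ν‖ + 9 / (8 * m)) ^ n
            * (1 + t / m) ^ n * Real.exp (-t / m)
          + 9 / 8 * m * κ * (Nat.factorial n : ℝ) * Real.exp (2 * κ * t)
            * (2 * κ + vecDiam ω₀ + vecDiam ν + 9 / (8 * m)) ^ n
            * (1 + t / m) ^ n * Real.exp (-t / m)
          + 3 / 4 * m * κ * (Nat.factorial (n + 1) : ℝ) * Real.exp (2 * κ * t)
            * (2 * κ + vecDiam ω₀ + vecDiam ν) ^ n * (1 - Real.exp (-t / m)) ∧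
      vecDiam (timeDeriv n (θ m) t - timeDeriv n (θ 0) t) ≤
        2 * (Nat.factorial (n - 1) : ℝ) * (2 * κ + vecDiam ω₀ + vecDiam ν + 9 / (8 * m)) ^ n
            * (1 + t / m) ^ n * Real.exp (-t / m)
          + 3 / 2 * (Nat.factorial (n + 1) : ℝ) * m * κ * Real.exp (2 * κ * t)
            * (2 * κ + vecDiam ω₀ + vecDiam ν + 9 / (8 * m)) ^ n
            * (1 + t / m) ^ n * Real.exp (-t / m)
          + 3 / 2 * (Nat.factorial (n + 1) : ℝ) * m * κ * Real.exp (2 * κ * t)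
            * (2 * κ + vecDiam ω₀ + vecDiam ν) ^ n * (1 - Real.exp (-t / m))) := by
  refine ⟨fun m hm i => ?_, tendstoC0_phase hN hκ hθ hθ0, fun m t hm ht => ?_,
    tendstoCInfty_phase hN hκ hθ hθ0, fun n m t hn hm ht i => ?_, fun m t hm ht => ?_,
    fun n m t hn hm ht => ?_⟩
  · rcases hm.eq_or_lt with rfl | hm
    · exact hθ0.contDiffOn i
    · exact (hθ m hm).contDiffOn hm i
  · exact ⟨fun i => abs_phase_sub_le hN hκ hm (hθ m hm) hθ0 i ht,
      norm_phase_sub_lt hN hκ hm (hθ m hm) hθ0 ht, vecDiam_phase_sub_lt hN hκ hm (hθ m hm) hθ0 ht⟩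
  · exact difference_timeDeriv_le_uniform hN hκ hm (hθ m hm) hθ0 hn ht i
  · exact ⟨norm_velocity_sub_lt hN hκ hm (hθ m hm) hθ0 ht,
      vecDiam_lt hN fun i j => abs_velocity_pair_sub_lt hN hκ hm (hθ m hm) hθ0 i j ht⟩
  · exact ⟨norm_difference_timeDeriv_le hN hκ hm (hθ m hm) hθ0 hn ht,
      vecDiam_difference_timeDeriv_le hN hκ hm (hθ m hm) hθ0 hn ht⟩
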